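/- Let $\omega\neq 0$ be a closed rational $1$-form on the complex projective plane $\mathbb{C}P(2)$, and let $\Omega=\pi^*\omega$ be its lift to $\mathbb{C}^3$, where $\pi:\mathbb{C}^3\setminus\{0\}\to\mathbb{C}P(2)$ is the canonical projection. Then there are an integer $r\ge 1$, polynomials $f_1,\dots,f_r,g\in\mathbb{C}[x_0,x_1,x_2]$, integers $n_1,\dots,n_r\ge 1$ and numbers $\lambda_1,\dots,\lambda_r\in\mathbb{C}$ such that $$\Omega=\sum_{j=1}^r\lambda_j\,\frac{df_j}{f_j}+d\left(\frac{g}{f_1^{n_1-1}\cdots f_r^{n_r-1}}\right)$$ and the following hold. (a) $f_1,\dots,f_r,g$ are homogeneous, and $f_j\nmid g$ for every $j$. Moreover $r\ge 2$ unless $\omega$ is exact, i.e. unless $\omega=dh$ for a rational function $h$ on $\mathbb{C}P(2)$. (b) $f_1,\dots,f_r$ are irreducible and pairwise relatively prime. (c) In particular, $f_j\nmid g$ whenever $n_j>1$. (d) $\deg g=\sum_{j=1}^r (n_j-1)\deg f_j$. (e) $\sum_{j=1}^r\lambda_j\deg f_j=0$. (f) If $n_j=1$, then $\lambda_j\neq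 0$. (g) The polar set of $\omega$ is $\bigcup_{j=1}^r (f_j=0)\subset\mathbb{C}P(2)$; for each $j$, $n_j$ is the order of the curve $(f_j=0)$ as a pole of $\omega$, and $\lambda_j$ is the residue of $\omega$ along $(f_j=0)$, that is, $\lambda_j=\frac{1}{2\pi i}\oint\omega$ over every sufficiently small positively oriented loop around the centre $p$ of a holomorphic disc transverse to $(f_j=0)$ at a smooth point $p$ of this curve that lies on no other irreducible component of the polar set. -/

import Mathlib

open MvPolynomial Filter Topology

open scoped KaehlerDifferential LinearAlgebra.Projectivization

noncomputable section

namespace CP2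

/-- The polynomial ring `ℂ[x₀, x₁, x₂]` of `ℂ³`, i.e. the homogeneous coordinate ring of `CP(2)`. -/
abbrev Poly : Type := MvPolynomial (Fin 3) ℂ

/-- The field `ℂ(x₀, x₁, x₂)` of rational functions on `ℂ³`. -/
abbrev RatC3 : Type := FractionRing Poly

/-- The complex projective plane, as the space of lines through the origin of `ℂ³`. -/
abbrev Plane : Type := ℙ ℂ (Fin 3 → ℂ)

/-- Polynomials, seen as rational functions on `ℂ³`. -/
abbrev toRat : Poly →+* RatC3 := algebraMap Poly RatC3

/-- The field of rational functions on `CP(2)`: the quotients `u / v` of homogeneous polynomials of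
the same degree. The inclusion into `ℂ(x₀, x₁, x₂)` is the pull-back of functions by the projection
`π : ℂ³ ∖ 0 → CP(2)`. -/
def FunField : IntermediateField ℂ RatC3 where
  carrier := {a | ∃ (d : ℕ) (u v : Poly), u.IsHomogeneous d ∧ v.IsHomogeneous d ∧ v ≠ 0 ∧
    a = toRat u / toRat v}
  mul_mem' := by
    rintro a b ⟨d, u, v, hu, hv, h0, rfl⟩ ⟨e, u', v', hu', hv', h0', rfl⟩
    refine ⟨d + e, u * u', v * v', hu.mul hu', hv.mul hv', mul_ne_zero h0 h0', ?_⟩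
    rw [map_mul, map_mul, div_mul_div_comm]
  add_mem' := by
    rintro a b ⟨d, u, v, hu, hv, h0, rfl⟩ ⟨e, u', v', hu', hv', h0', rfl⟩
    refine ⟨d + e, u * v' + v * u', v * v', (hu.mul hv').add (hv.mul hu'), hv.mul hv',
      mul_ne_zero h0 h0', ?_⟩
    have h1 : toRat v ≠ 0 := by simpa using h0
    have h2 : toRat v' ≠ 0 := by simpa using h0'
    rw [map_add, map_mul, map_mul, map_mul, div_add_div _ _ h1 h2]
  algebraMap_mem' := by
    intro c
    refine ⟨0, C c, 1, isHomogeneous_C _ c, isHomogeneous_one _ _, one_ne_zero, ?_⟩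
    rw [map_one, div_one, IsScalarTower.algebraMap_apply ℂ Poly RatC3]
    rfl
  inv_mem' := by
    rintro a ⟨d, u, v, hu, hv, h0, rfl⟩
    by_cases h : u = 0
    · exact ⟨0, 0, 1, isHomogeneous_zero _ _ _, isHomogeneous_one _ _, one_ne_zero, by simp [h]⟩
    · exact ⟨d, v, u, hv, hu, h, by rw [inv_div]⟩

/-- Rational `1`-forms on `CP(2)`: the Kähler differentials of its field of rational functions. -/
abbrev RatForm : Type := Ω[FunField⁄ℂ]

/-- The lift `π^*ω` of a rational `1`-form on `CP(2)` to a rational `1`-form on `ℂ³`; it sends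
`a db` to `(a ∘ π) d(b ∘ π)`. -/
def lift (ω : RatForm) : Ω[RatC3⁄ℂ] :=
  KaehlerDifferential.map ℂ ℂ FunField RatC3 ω

/-- A rational `1`-form `ω` is closed if `dω = 0`, where
`dω(X, Y) = X(ω(Y)) - Y(ω(X)) - ω([X, Y])` for all rational vector fields `X`, `Y`. -/
def ClosedForm (ω : RatForm) : Prop :=
  ∀ X Y : Derivation ℂ FunField FunField,
    X (Y.liftKaehlerDifferential ω) - Y (X.liftKaehlerDifferential ω)
      - (⁅X, Y⁆ : Derivation ℂ FunField FunField).liftKaehlerDifferential ω = 0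

/-- The rational functions on `CP(2)` with a denominator in `S`. -/
def localRing (S : Submonoid Poly) : Subalgebra ℂ FunField where
  carrier := {a | ∃ (d : ℕ) (u v : Poly), u.IsHomogeneous d ∧ v.IsHomogeneous d ∧ v ≠ 0 ∧ v ∈ S ∧
    (a : RatC3) = toRat u / toRat v}
  mul_mem' := by
    rintro a b ⟨d, u, v, hu, hv, h0, hS, ha⟩ ⟨e, u', v', hu', hv', h0', hS', hb⟩
    refine ⟨d + e, u * u', v * v', hu.mul hu', hv.mul hv', mul_ne_zero h0 h0',
      S.mul_mem hS hS', ?_⟩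
    rw [map_mul, map_mul, ← div_mul_div_comm, ← ha, ← hb]
    rfl
  add_mem' := by
    rintro a b ⟨d, u, v, hu, hv, h0, hS, ha⟩ ⟨e, u', v', hu', hv', h0', hS', hb⟩
    refine ⟨d + e, u * v' + v * u', v * v', (hu.mul hv').add (hv.mul hu'), hv.mul hv',
      mul_ne_zero h0 h0', S.mul_mem hS hS', ?_⟩
    have h1 : toRat v ≠ 0 := by simpa using h0
    have h2 : toRat v' ≠ 0 := by simpa using h0'
    rw [map_add, map_mul, map_mul, map_mul, ← div_add_div _ _ h1 h2, ← ha, ← hb]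
    rfl
  algebraMap_mem' := by
    intro c
    refine ⟨0, C c, 1, isHomogeneous_C _ c, isHomogeneous_one _ _, one_ne_zero, S.one_mem, ?_⟩
    rw [map_one, div_one]
    change algebraMap ℂ RatC3 c = _
    rw [IsScalarTower.algebraMap_apply ℂ Poly RatC3]
    rfl

/-- The `1`-forms `∑ aᵢ dbᵢ` with `aᵢ`, `bᵢ` in the local ring attached to `S`. -/
def regularForms (S : Submonoid Poly) : Submodule (localRing S) RatForm :=
  Submodule.span (localRing S)
    ((fun b : FunField => KaehlerDifferential.D ℂ FunField b) '' (localRing S : Set FunField))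

/-- The polynomials that do not vanish at `v`; `localRing (nonvanishingAt v)` is the local ring of
`CP(2)` at the point `[v]`. -/
def nonvanishingAt (v : Fin 3 → ℂ) : Submonoid Poly where
  carrier := {w | eval v w ≠ 0}
  mul_mem' := by
    intro a b ha hb
    simpa using ⟨ha, hb⟩
  one_mem' := by simp

/-- The polynomials that are non-zero-divisors modulo `f`. For `f` irreducible these are the
polynomials that do not vanish identically on the curve `(f = 0)`, see `mem_nonvanishingAlong`, and
`localRing (nonvanishingAlong f)` is the local ring of `CP(2)` along this curve. -/
def nonvanishingAlong (f : Poly) : Submonoid Poly where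
  carrier := {w | ∀ u, f ∣ w * u → f ∣ u}
  mul_mem' := by
    intro a b ha hb u h
    exact hb u (ha _ (by rwa [← mul_assoc]))
  one_mem' := by
    intro u h
    simpa using h

theorem mem_nonvanishingAlong {f : Poly} (hf : Irreducible f) (w : Poly) :
    w ∈ nonvanishingAlong f ↔ ¬ f ∣ w := by
  constructor
  · intro h hw
    exact hf.not_isUnit (isUnit_of_dvd_one (h 1 (by simpa using hw)))
  · intro h u hu
    exact (hf.prime.dvd_or_dvd hu).resolve_left h

/-- The polar set `(ω)_∞ ⊂ CP(2)`: the points where `ω` is not regular (holomorphic). -/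
def polarSet (ω : RatForm) : Set Plane :=
  {p | ω ∉ regularForms (nonvanishingAt p.rep)}

/-- The algebraic curve `(f = 0) ⊂ CP(2)` of a homogeneous polynomial `f`. -/
def curve (f : Poly) : Set Plane :=
  {p | eval p.rep f = 0}

/-- For `f` homogeneous and irreducible: the curve `(f = 0)` has order `n` as a pole of `ω`. That is,
`n` is the least `m` such that `a ω` is regular along the curve for every rational function `a` that
vanishes to order at least `m` along the curve. -/
def HasPoleOrder (f : Poly) (ω : RatForm) (n : ℕ) : Prop :=
  IsLeast {m : ℕ | ∀ a : FunField,
    (∃ (d : ℕ) (u v : Poly), (f ^ m * u).IsHomogeneous d ∧ v.IsHomogeneous d ∧ v ≠ 0 ∧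
      v ∈ nonvanishingAlong f ∧ (a : RatC3) = toRat (f ^ m * u) / toRat v) →
    a • ω ∈ regularForms (nonvanishingAlong f)} n

/-- The value at `v` of a rational function on `ℂ³` (in lowest terms). -/
def ratEval (v : Fin 3 → ℂ) (a : RatC3) : ℂ :=
  eval v (IsFractionRing.num Poly a) / eval v (IsFractionRing.den Poly a : Poly)

/-- `γ` is (a lift to `ℂ³ ∖ 0` of) a holomorphic disc in `CP(2)` which is transverse to the curve
`(f = 0)` at its centre `[γ 0]`, a smooth point of `(f = 0)` that lies on no other irreducible
component of the polar set of `ω`. -/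
structure IsTransverseDisc (f : Poly) (ω : RatForm) (γ : ℂ → Fin 3 → ℂ) : Prop where
  analytic : AnalyticAt ℂ γ 0
  ne_zero : γ 0 ≠ 0
  mem_curve : eval (γ 0) f = 0
  transverse : deriv (fun t => eval (γ t) f) 0 ≠ 0
  off_other_poles : ∀ (h : Poly) (d : ℕ), Irreducible h → h.IsHomogeneous d →
    curve h ⊆ polarSet ω → eval (γ 0) h = 0 → Associated h f

/-- For `f` homogeneous and irreducible: the residue of `ω` along `(f = 0)` is `c`. That is,
`(2πi)⁻¹ ∮ ω = c` over small positively oriented loops around the centre of every disc transverse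
to `(f = 0)`. Here `A₀ dx₀ + A₁ dx₁ + A₂ dx₂ = π^*ω`, so that
`∑ Aᵢ(γ(t)) γᵢ'(t) dt = γ^*(π^*ω) = (π ∘ γ)^*ω`. -/
def HasResidue (f : Poly) (ω : RatForm) (c : ℂ) : Prop :=
  ∃ A : Fin 3 → RatC3,
    lift ω = ∑ i, A i • KaehlerDifferential.D ℂ RatC3 (toRat (X i)) ∧
    ∀ γ : ℂ → Fin 3 → ℂ, IsTransverseDisc f ω γ →
      ∀ᶠ ρ in 𝓝[>] (0 : ℝ),
        (2 * (Real.pi : ℂ) * Complex.I)⁻¹ *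
          (∮ t in C(0, ρ), ∑ i, ratEval (γ t) (A i) * deriv γ t i) = c

end CP2

end

/-!
A closed rational `1`-form on the plane is integrated one variable at a time, and the normal form is
read off from the result.

*Integration.* In affine coordinates `s`, `t` the function field of the plane is `L(t)` with
`L = ℂ(s)`, and a closed form is `A ds + B dt` with `∂B/∂s = ∂A/∂t`. Hermite reduction over the
differential field `L` writes `B` as a derivative in `t` plus simple fractions `p / q` with distinct
monic irreducible `q ∈ L[t]`. Let `c` be the residue of such a fraction, so that `p ≡ c q'` modulo
`q`. The derivation `∂/∂s` extends uniquely to the finite extension `L[t]/(q)` of `L`, and modulo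
exact and `q`-regular terms `∂/∂s (c q'/q)` is the derivative of `c` times `q'/q`. As
`∂B/∂s` is exact in `t` and a derivative has no simple pole, `c` is a constant of `L[t]/(q)`. Such a
constant is algebraic over the constants `ℂ` of `L`, so it is a complex number
(`exists_eq_const_mul_logDeriv_add`). Hence `B` is a `ℂ`-combination of logarithmic derivatives plus
a derivative (`mem_logExact_of_parameterDerivation_exact`). What remains of the form is `A ds` with
`A ∈ ℂ(s)`, to which the same statement applies with `L = ℂ`. So every closed form is
`∑ λ dF / F + dG` with `F`, `G` rational functions on the plane (`ClosedForm.mem_logExact`).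

*Normal form.* Factors of homogeneous polynomials are homogeneous, so each `dF / F` lifts to a
combination of `df / f` with `f` irreducible and homogeneous, with coefficients whose sum weighted
by the degrees is zero. Put `G` in lowest terms. The `fⱼ` are the curves that occur with a nonzero
coefficient or in the denominator of `G`, and `nⱼ - 1` is their exponent in this denominator.
Adding a general constant to `G` makes its numerator coprime to those `fⱼ` with `nⱼ = 1` as well
(`exists_isNormalForm`).

*Poles and residues.* By Euler's identity some `∂ᵢ fⱼ` is not divisible by `fⱼ`, and the polar part
of the coefficient of `dxᵢ` shows that the pole along `fⱼ` has order at least `nⱼ`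
(`IsNormalForm.pow_mul_coeffForm_notMem`). Conversely, on the plane the form is
`∑ cⱼ dFⱼ / Fⱼ + dG` with `Fⱼ = fⱼ / xᵢ ^ deg fⱼ` for any coordinate `xᵢ`, because
`∑ cⱼ deg fⱼ = 0`; with `xᵢ` invertible this shows regularity off the curves and bounds the pole
orders. Along a transverse disc only `fⱼ` vanishes at the centre, and to first order, so the
pulled-back form is `cⱼ dt / t` plus an exact and a holomorphic form.
-/

noncomputable section

namespace CP2

/-! ### Logarithmic-exact elements of a module with a derivation -/

section LogExact

variable {k K M N : Type*} [Field k] [Field K] [Algebra k K] [AddCommGroup M] [Module k M]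
  [Module K M] [AddCommGroup N] [Module k N] [Module K N]

/-- The `k`-linear combinations of exact elements `dG` and logarithmic differentials `dF / F`, for a
derivation `d` of the field `K`. -/
def logExact (D : Derivation k K M) : Submodule k M :=
  Submodule.span k (Set.range D ∪ {x | ∃ F : K, F ≠ 0 ∧ x = F⁻¹ • D F})

theorem apply_mem_logExact (D : Derivation k K M) (G : K) : D G ∈ logExact D :=
  Submodule.subset_span (Or.inl ⟨G, rfl⟩)

theorem inv_smul_apply_mem_logExact (D : Derivation k K M) {F : K} (hF : F ≠ 0) :
    F⁻¹ • D F ∈ logExact D :=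
  Submodule.subset_span (Or.inr ⟨F, hF, rfl⟩)

theorem logExact_induction {D : Derivation k K M} {P : (x : M) → x ∈ logExact D → Prop}
    (exact : ∀ G, P (D G) (apply_mem_logExact D G))
    (log : ∀ F (hF : F ≠ 0), P (F⁻¹ • D F) (inv_smul_apply_mem_logExact D hF))
    (add : ∀ x y hx hy, P x hx → P y hy → P (x + y) (add_mem hx hy))
    (smul : ∀ (c : k) x hx, P x hx → P (c • x) (Submodule.smul_mem _ c hx)) {x : M}
    (hx : x ∈ logExact D) : P x hx := by
  refine Submodule.span_induction (p := fun x hx => P x hx) ?_ ?_ add smul hx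
  · rintro x (⟨G, rfl⟩ | ⟨F, hF, rfl⟩)
    · exact exact G
    · exact log F hF
  · simpa using exact 0

end LogExact

/-! ### Integration of rational functions in one variable over a differential field -/

section OneVariable

open scoped Polynomial
open Polynomial (aeval derivative)

variable {L K : Type*} [Field L] [Field K] [Algebra L K]
  {δ : Derivation L K K} {t : K}

theorem apply_aeval (hδ : δ t = 1) (p : L[X]) : δ (aeval t p) = aeval t (derivative p) := by
  rw [Derivation.map_aeval, hδ, smul_eq_mul, mul_one]

/-- The elements of `L(t)` of the shape `δ R + ∑ p / q`, where `q` runs over distinct monic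
irreducible polynomials. -/
def IsHermiteReduced (δ : Derivation L K K) (t x : K) : Prop :=
  ∃ (R : K) (P : L[X] →₀ L[X]), (∀ q ∈ P.support, q.Monic ∧ Irreducible q) ∧
    x = δ R + P.sum fun q p => aeval t p / aeval t q

theorem IsHermiteReduced.add {x y : K} (hx : IsHermiteReduced δ t x)
    (hy : IsHermiteReduced δ t y) : IsHermiteReduced δ t (x + y) := by
  classical
  obtain ⟨R, P, hP, rfl⟩ := hx
  obtain ⟨R', P', hP', rfl⟩ := hy
  refine ⟨R + R', P + P', fun q hq => ?_, ?_⟩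
  · rcases Finset.mem_union.1 (Finsupp.support_add hq) with h | h
    · exact hP q h
    · exact hP' q h
  · rw [Finsupp.sum_add_index' (by simp) (by simp [add_div]), map_add]
    ring

theorem isHermiteReduced_apply (R : K) : IsHermiteReduced δ t (δ R) :=
  ⟨R, 0, by simp, by simp⟩

variable [CharZero L]

theorem exists_derivative_eq (p : L[X]) : ∃ P : L[X], derivative P = p := by
  induction p using Polynomial.induction_on' with
  | add p q hp hq =>
    obtain ⟨P, rfl⟩ := hp
    obtain ⟨Q, rfl⟩ := hq
    exact ⟨P + Q, by simp⟩
  | monomial n a =>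
    refine ⟨Polynomial.monomial (n + 1) (a / (n + 1)), ?_⟩
    have : (n + 1 : L) ≠ 0 := by exact_mod_cast n.succ_ne_zero
    rw [Polynomial.derivative_monomial]
    push_cast
    rw [div_mul_cancel₀ _ this]

theorem aeval_ne_zero (hδ : δ t = 1) {p : L[X]} (hp : p ≠ 0) : aeval t p ≠ 0 := by
  induction h : p.natDegree using Nat.strong_induction_on generalizing p with
  | _ n ih =>
    intro h0
    rcases Nat.eq_zero_or_pos n with rfl | hn
    · rw [Polynomial.eq_C_of_natDegree_eq_zero h] at h0 hp
      simp at h0 hp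
      exact hp h0
    · have h1 : derivative p ≠ 0 := by
        intro h2
        have := Polynomial.derivative_eq_zero.1 h2
        omega
      refine ih _ ?_ h1 rfl (by rw [← apply_aeval hδ, h0, map_zero])
      rw [← h]
      exact Polynomial.natDegree_derivative_lt (by omega)

theorem aeval_ne_zero_of_not_dvd (hδ : δ t = 1) {q b : L[X]} (hb : ¬ q ∣ b) : aeval t b ≠ 0 :=
  aeval_ne_zero hδ (by rintro rfl; exact hb (dvd_zero q))

theorem aeval_injective (hδ : δ t = 1) : Function.Injective (aeval t : L[X] → K) := by
  intro p q h
  by_contra hpq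
  exact aeval_ne_zero hδ (sub_ne_zero.2 hpq) (by rw [map_sub, h, sub_self])

/-- In characteristic zero, the constants of `d/dt` on `L(t)` are the elements of `L`. -/
theorem mem_range_of_apply_eq_zero (hδ : δ t = 1)
    (hfrac : ∀ x : K, ∃ p q : L[X], q ≠ 0 ∧ x = aeval t p / aeval t q) {x : K} (hx : δ x = 0) :
    x ∈ Set.range (algebraMap L K) := by
  classical
  obtain ⟨p, q, hq, rfl⟩ := hfrac x
  obtain ⟨p, q, c, hpq, rfl, rfl⟩ := UniqueFactorizationMonoid.exists_reduced_factors' p q hq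
  have hc : c ≠ 0 := left_ne_zero_of_mul hq
  have hq0 : q ≠ 0 := right_ne_zero_of_mul hq
  have hc' := aeval_ne_zero hδ hc
  have hq' := aeval_ne_zero hδ hq0
  rw [map_mul, map_mul, mul_div_mul_left _ _ hc'] at hx ⊢
  rw [Derivation.leibniz_div, smul_eq_mul, mul_eq_zero, or_iff_right (by simp [hq']), smul_eq_mul,
    smul_eq_mul, apply_aeval hδ, apply_aeval hδ, ← map_mul, ← map_mul, sub_eq_zero] at hx
  have h := aeval_injective hδ hx
  -- `q p' = p q'` with `p`, `q` coprime forces `q ∣ q'`, so `q` is constant, and then so is `p`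
  have hdvd : q ∣ derivative q := hpq.symm.dvd_of_dvd_mul_left (Dvd.intro _ h)
  have hq1 : derivative q = 0 := by
    by_contra h1
    have h2 : q.natDegree ≠ 0 := fun h2 => h1 (Polynomial.derivative_of_natDegree_zero h2)
    exact absurd (Polynomial.natDegree_le_of_dvd hdvd h1)
      (not_le.2 (Polynomial.natDegree_derivative_lt h2))
  have hp1 : derivative p = 0 := by
    rw [hq1, mul_zero] at h
    exact (mul_eq_zero.1 h).resolve_left hq0
  rw [Polynomial.eq_C_of_natDegree_eq_zero (Polynomial.derivative_eq_zero.1 hp1),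
    Polynomial.eq_C_of_natDegree_eq_zero (Polynomial.derivative_eq_zero.1 hq1)]
  exact ⟨p.coeff 0 / q.coeff 0, by simp⟩

theorem isCoprime_derivative {q : L[X]} (hq : Irreducible q) : IsCoprime q (derivative q) :=
  (Polynomial.separable_def q).1 hq.separable

theorem not_dvd_derivative {q : L[X]} (hq : Irreducible q) : ¬ q ∣ derivative q := fun h =>
  hq.not_isUnit ((isCoprime_derivative hq).isUnit_of_dvd' dvd_rfl h)

theorem isHermiteReduced_aeval (hδ : δ t = 1) (p : L[X]) : IsHermiteReduced δ t (aeval t p) := by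
  obtain ⟨P, rfl⟩ := exists_derivative_eq p
  rw [← apply_aeval hδ]
  exact isHermiteReduced_apply _

/-- Hermite reduction: the order of a pole of order at least two is lowered modulo exact
elements. -/
theorem isHermiteReduced_div_pow (hδ : δ t = 1) {q : L[X]} (hm : q.Monic) (hq : Irreducible q)
    (n : ℕ) (p : L[X]) : IsHermiteReduced δ t (aeval t p / aeval t q ^ n) := by
  induction n generalizing p with
  | zero => simpa using isHermiteReduced_aeval hδ p
  | succ n ih =>
    rcases Nat.eq_zero_or_pos n with rfl | hn
    · refine ⟨0, Finsupp.single q p, fun r hr => ?_, ?_⟩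
      · have := Finsupp.support_single_subset hr
        rw [Finset.mem_singleton] at this
        exact this ▸ ⟨hm, hq⟩
      · rw [Finsupp.sum_single_index (by simp)]
        simp
    · obtain ⟨a, b, hab⟩ := isCoprime_derivative hq
      have hn0 : (n : L) ≠ 0 := by exact_mod_cast hn.ne'
      have hK : CharZero K := charZero_of_injective_algebraMap (algebraMap L K).injective
      have hn1 : (n : K) ≠ 0 := by exact_mod_cast hn.ne'
      have hq0 := aeval_ne_zero hδ hq.ne_zero
      set e : L := (n : L)⁻¹ with he
      have hpab : p = p * a * q + p * b * derivative q := by linear_combination (-p) * hab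
      have key : aeval t p / aeval t q ^ (n + 1) =
          aeval t (p * a + Polynomial.C e * derivative (p * b)) / aeval t q ^ n +
            δ (aeval t (-(Polynomial.C e * (p * b))) / aeval t q ^ n) := by
        have hm1 : aeval t q ^ n = aeval t q ^ (n - 1) * aeval t q := by
          rw [← pow_succ, Nat.sub_add_cancel hn]
        have hz := pow_ne_zero (n - 1) hq0
        rw [Derivation.leibniz_div, Derivation.leibniz_pow, apply_aeval hδ, apply_aeval hδ]
        conv_lhs => rw [hpab]
        simp only [map_neg, map_add, map_mul, Polynomial.derivative_C_mul,
          Polynomial.aeval_C, smul_eq_mul, nsmul_eq_mul, he, map_inv₀, map_natCast, pow_succ, hm1]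
        field_simp
        ring
      rw [key]
      exact (ih _).add (isHermiteReduced_apply _)

theorem isHermiteReduced_of_frac (hδ : δ t = 1) (q : L[X]) (hq : q ≠ 0) (p : L[X]) :
    IsHermiteReduced δ t (aeval t p / aeval t q) := by
  induction q using UniqueFactorizationMonoid.induction_on_coprime generalizing p with
  | h0 => exact absurd rfl hq
  | h1 h =>
    obtain ⟨c, hc, rfl⟩ := Polynomial.isUnit_iff.1 h
    have := isHermiteReduced_aeval (K := K) hδ (Polynomial.C c⁻¹ * p)
    simpa [div_eq_inv_mul] using this
  | @hpr q n h =>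
    have hl : q.leadingCoeff ≠ 0 := by simpa using h.ne_zero
    have hm := Polynomial.monic_mul_leadingCoeff_inv h.ne_zero
    have hi : Irreducible (q * Polynomial.C q.leadingCoeff⁻¹) :=
      (irreducible_mul_isUnit (Polynomial.isUnit_C.2 (by simpa using hl))).2 h.irreducible
    have := isHermiteReduced_div_pow hδ hm hi n (Polynomial.C q.leadingCoeff⁻¹ ^ n * p)
    have hl' : algebraMap L K q.leadingCoeff ≠ 0 := by simpa using hl
    have hq0 := aeval_ne_zero hδ h.ne_zero
    convert this using 1
    simp only [map_mul, map_pow, Polynomial.aeval_C, map_inv₀, mul_pow]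
    rw [mul_comm (aeval t q ^ n), mul_div_mul_left]
    exact pow_ne_zero _ (inv_ne_zero hl')
  | @hcp x y h hx hy =>
    have hx0 := left_ne_zero_of_mul hq
    have hy0 := right_ne_zero_of_mul hq
    obtain ⟨a, b, hab⟩ := h.isCoprime
    convert (hy hy0 (p * a)).add (hx hx0 (p * b)) using 1
    have h1 := aeval_ne_zero hδ hx0
    have h2 := aeval_ne_zero hδ hy0
    have h3 := congrArg (aeval t : L[X] → K) hab
    simp only [map_add, map_mul, map_one] at h3 ⊢
    field_simp
    linear_combination (-aeval t p) * h3

/-- The elements of `L(t)` without a pole along `q`. -/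
def regularAt (hδ : δ t = 1) {q : L[X]} (hq : Irreducible q) : Subring K where
  carrier := {x | ∃ a b : L[X], ¬ q ∣ b ∧ x = aeval t a / aeval t b}
  mul_mem' := by
    rintro x y ⟨a, b, hb, rfl⟩ ⟨a', b', hb', rfl⟩
    exact ⟨a * a', b * b', fun h => (hq.prime.dvd_or_dvd h).elim hb hb', by
      rw [map_mul, map_mul, div_mul_div_comm]⟩
  one_mem' := ⟨1, 1, hq.not_dvd_one, by simp⟩
  add_mem' := by
    rintro x y ⟨a, b, hb, rfl⟩ ⟨a', b', hb', rfl⟩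
    refine ⟨a * b' + b * a', b * b', fun h => (hq.prime.dvd_or_dvd h).elim hb hb', ?_⟩
    rw [div_add_div _ _ (aeval_ne_zero_of_not_dvd hδ hb)
      (aeval_ne_zero_of_not_dvd hδ hb')]
    simp
  zero_mem' := ⟨0, 1, hq.not_dvd_one, by simp⟩
  neg_mem' := by
    rintro x ⟨a, b, hb, rfl⟩
    exact ⟨-a, b, hb, by rw [map_neg, neg_div]⟩

variable {q : L[X]}

theorem aeval_div_mem_regularAt (hδ : δ t = 1) (hq : Irreducible q) (a : L[X]) {b : L[X]}
    (hb : ¬ q ∣ b) : aeval t a / aeval t b ∈ regularAt hδ hq := ⟨a, b, hb, rfl⟩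

theorem aeval_mem_regularAt (hδ : δ t = 1) (hq : Irreducible q) (a : L[X]) :
    aeval t a ∈ regularAt hδ hq := ⟨a, 1, hq.not_dvd_one, by simp⟩

theorem apply_mem_regularAt (hδ : δ t = 1) (hq : Irreducible q) {x : K}
    (hx : x ∈ regularAt hδ hq) : δ x ∈ regularAt hδ hq := by
  obtain ⟨a, b, hb, rfl⟩ := hx
  refine ⟨b * derivative a - a * derivative b, b ^ 2, fun h => hb (hq.prime.dvd_of_dvd_pow h), ?_⟩
  rw [Derivation.leibniz_div, apply_aeval hδ, apply_aeval hδ]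
  simp only [map_sub, map_mul, map_pow, smul_eq_mul]
  rw [inv_pow, div_eq_inv_mul]

theorem dvd_of_div_mem_regularAt (hδ : δ t = 1) (hq : Irreducible q) {e : L[X]}
    (h : aeval t e / aeval t q ∈ regularAt hδ hq) : q ∣ e := by
  obtain ⟨a, b, hb, h⟩ := h
  rw [div_eq_div_iff (aeval_ne_zero hδ hq.ne_zero)
    (aeval_ne_zero_of_not_dvd hδ hb), ← map_mul, ← map_mul] at h
  exact (hq.prime.dvd_or_dvd (Dvd.intro_left a (aeval_injective hδ h).symm)).resolve_right hb

/-- A derivative never has a simple pole. -/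
theorem dvd_of_apply_sub_div_mem_regularAt (hδ : δ t = 1) (hq : Irreducible q)
    (hfrac : ∀ x : K, ∃ p q : L[X], q ≠ 0 ∧ x = aeval t p / aeval t q) {A : K} {e : L[X]}
    (h : δ A - aeval t e / aeval t q ∈ regularAt hδ hq) : q ∣ e := by
  have hq0 := aeval_ne_zero hδ hq.ne_zero
  by_cases hA : A ∈ regularAt hδ hq
  · exact dvd_of_div_mem_regularAt hδ hq
      (by simpa only [sub_sub_cancel] using sub_mem (apply_mem_regularAt hδ hq hA) h)
  exfalso
  obtain ⟨m, a, b, ha, hb, hm, hA'⟩ : ∃ (m : ℕ) (a b : L[X]), ¬ q ∣ a ∧ ¬ q ∣ b ∧ m ≠ 0 ∧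
      A = aeval t a / aeval t b / aeval t q ^ m := by
    obtain ⟨p, r, hr, rfl⟩ := hfrac A
    have hp : p ≠ 0 := by
      rintro rfl
      exact hA (by simp)
    obtain ⟨a, hpa, ha⟩ :=
      (FiniteMultiplicity.of_not_isUnit hq.not_isUnit hp).exists_eq_pow_mul_and_not_dvd
    obtain ⟨b, hrb, hb⟩ :=
      (FiniteMultiplicity.of_not_isUnit hq.not_isUnit hr).exists_eq_pow_mul_and_not_dvd
    generalize multiplicity q p = i at hpa
    generalize multiplicity q r = j at hrb
    subst hpa hrb
    have hb0 : aeval t b ≠ 0 := aeval_ne_zero_of_not_dvd hδ hb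
    rcases le_or_gt j i with hij | hij
    · refine absurd ⟨q ^ (i - j) * a, b, hb, ?_⟩ hA
      obtain ⟨l, rfl⟩ := Nat.exists_eq_add_of_le hij
      rw [Nat.add_sub_cancel_left]
      simp only [map_mul, map_pow, pow_add]
      field_simp
    · obtain ⟨l, rfl⟩ := Nat.exists_eq_add_of_lt hij
      refine ⟨l + 1, a, b, ha, hb, by omega, ?_⟩
      simp only [map_mul, map_pow, pow_add]
      field_simp
  have hb0 : aeval t b ≠ 0 := aeval_ne_zero_of_not_dvd hδ hb
  set u : K := aeval t a / aeval t b with hu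
  have hur : u ∈ regularAt hδ hq := aeval_div_mem_regularAt hδ hq a hb
  obtain ⟨n, rfl⟩ := Nat.exists_eq_succ_of_ne_zero hm
  have hK : CharZero K := charZero_of_injective_algebraMap (algebraMap L K).injective
  -- multiply by `q ^ m`, which leaves `m u q' / q` as the only possible pole
  have h1 : aeval t ((n.succ : L[X]) * a * derivative q) / aeval t q ∈ regularAt hδ hq := by
    have hA1 : aeval t ((n.succ : L[X]) * a * derivative q) / aeval t q = aeval t b *
        (δ u - aeval t q ^ n.succ * (δ A - aeval t e / aeval t q) - aeval t (q ^ n * e)) := by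
      have hub : aeval t a = u * aeval t b := by rw [hu]; field_simp
      rw [hA', Derivation.leibniz_div δ u, Derivation.leibniz_pow, apply_aeval hδ q]
      simp only [map_mul, hub, map_pow, Nat.succ_eq_add_one, Nat.add_sub_cancel, smul_eq_mul,
        nsmul_eq_mul, map_natCast, pow_succ]
      field_simp
      ring
    rw [hA1]
    refine mul_mem (aeval_mem_regularAt hδ hq _) (sub_mem (sub_mem (apply_mem_regularAt hδ hq hur)
      (mul_mem (pow_mem (aeval_mem_regularAt hδ hq _) _) h)) (aeval_mem_regularAt hδ hq _))
  rcases hq.prime.dvd_or_dvd (dvd_of_div_mem_regularAt hδ hq h1) with h2 | h2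
  · rcases hq.prime.dvd_or_dvd h2 with h3 | h3
    · have : IsUnit ((n.succ : L[X])) := by
        rw [← Polynomial.C_eq_natCast, Polynomial.isUnit_C]
        exact IsUnit.mk0 _ (by exact_mod_cast n.succ_ne_zero)
      exact hq.not_isUnit (isUnit_of_dvd_unit h3 this)
    · exact ha h3
  · exact not_dvd_derivative hq h2

end OneVariable

/-! ### Constancy of residues -/

section Residues

open scoped Polynomial Differential
open Polynomial (aeval derivative)
open Differential (mapCoeffs implicitDeriv)

theorem apply_aeval_eq_mapCoeffs_add {R L A : Type*} [CommRing R] [CommRing L] [Differential L]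
    [CommRing A] [Algebra R A] [Algebra L A] {d : Derivation R A A}
    (hd : ∀ a : L, d (algebraMap L A a) = algebraMap L A a′) (x : A) (p : L[X]) :
    d (aeval x p) = aeval x (mapCoeffs p) + aeval x (derivative p) * d x := by
  induction p using Polynomial.induction_on' with
  | add p q hp hq =>
    simp only [map_add, hp, hq]
    ring
  | monomial n a =>
    simp only [Polynomial.aeval_monomial, Derivation.leibniz, Derivation.leibniz_pow, hd,
      smul_eq_mul, nsmul_eq_mul, Differential.mapCoeffs_monomial, Polynomial.derivative_monomial,
      map_mul, map_natCast]
    ring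

variable {k L K : Type*} [Field k] [Field L] [Field K] [Algebra k L] [Algebra L K] [Algebra k K]
  [IsScalarTower k L K] [Differential L] {q : L[X]}

/-- If `D` is the derivation of `L[X]` extending that of `L` with `D X = w`, and `D` preserves the
ideal of `q`, then `D` induces a derivation of `L[X]/(q)`, which is algebraic over `L`; so its
constants are algebraic over the constants of `L`. -/
theorem exists_dvd_sub_of_dvd_implicitDeriv [IsAlgClosed k]
    (hconst : ∀ a : L, a′ = 0 → a ∈ Set.range (algebraMap k L)) (hq : Irreducible q)
    {w c : L[X]} (hw : q ∣ implicitDeriv w q) (hc : q ∣ implicitDeriv w c) :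
    ∃ κ : k, q ∣ c - Polynomial.C (algebraMap k L κ) := by
  have : Fact (Irreducible q) := ⟨hq⟩
  set α : AdjoinRoot q := AdjoinRoot.mk q c with hα
  have hev : ∀ p : L[X], aeval α p = AdjoinRoot.mk q (aeval c p) := fun p => by
    rw [hα, ← AdjoinRoot.mkₐ_toRingHom]
    exact Polynomial.aeval_algHom_apply (AdjoinRoot.mkₐ q) c p
  have hfin : Module.Finite L (AdjoinRoot q) := (AdjoinRoot.powerBasis hq.ne_zero).finite
  have hint : IsIntegral L α := IsIntegral.of_finite L α
  set μ := minpoly L α with hμ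
  have hmonic : μ.Monic := minpoly.monic hint
  have h1 : q ∣ aeval c μ := by
    rw [← AdjoinRoot.mk_eq_zero, ← hev, hμ, minpoly.aeval]
  have h2 : q ∣ implicitDeriv w (aeval c μ) := by
    obtain ⟨g, hg⟩ := h1
    rw [hg, Derivation.leibniz]
    exact dvd_add (Dvd.intro _ rfl) (hw.mul_left g)
  rw [apply_aeval_eq_mapCoeffs_add (fun a => by simp [Polynomial.algebraMap_eq])] at h2
  have h3 : aeval α (mapCoeffs μ) = 0 := by
    rw [hev, AdjoinRoot.mk_eq_zero]
    exact (dvd_add_left (hc.mul_left _)).1 h2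
  -- differentiating the coefficients of the monic `μ` lowers its degree
  have h4 : mapCoeffs μ = 0 := by
    by_contra h
    refine absurd (minpoly.degree_le_of_ne_zero L α h h3) (not_le.2 ?_)
    rw [← hμ, Polynomial.degree_eq_natDegree hmonic.ne_zero, Polynomial.degree_lt_iff_coeff_zero]
    intro m hm
    rw [Differential.coeff_mapCoeffs]
    rcases hm.eq_or_lt with rfl | hm
    · rw [hmonic.coeff_natDegree]
      exact Derivation.map_one_eq_zero _
    · rw [Polynomial.coeff_eq_zero_of_natDegree_lt hm, map_zero]
  obtain ⟨ν, hν⟩ : μ ∈ Polynomial.lifts (algebraMap k L) := by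
    rw [Polynomial.lifts_iff_coeff_lifts]
    intro n
    exact hconst _ (by rw [← Differential.coeff_mapCoeffs, h4, Polynomial.coeff_zero])
  have hν' : ν.map (algebraMap k L) = μ := hν
  obtain ⟨κ, hκ⟩ := IsAlgClosed.exists_root ν (by
    rw [← Polynomial.degree_map ν (algebraMap k L), hν']
    exact (minpoly.degree_pos hint).ne')
  refine ⟨κ, ?_⟩
  have h5 : μ.IsRoot (algebraMap k L κ) := by
    rw [← hν']
    exact hκ.map
  rw [← AdjoinRoot.mk_eq_zero, map_sub, ← hα, ← minpoly.root hint h5]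
  exact sub_self _

variable {δ : Derivation L K K} {t : K} {R : Type*} [CommRing R] [Algebra R K]
  {d : Derivation R K K}

theorem apply_aeval_eq_mapCoeffs (hd : ∀ a : L, d (algebraMap L K a) = algebraMap L K a′)
    (hdt : d t = 0) (p : L[X]) : d (aeval t p) = aeval t (mapCoeffs p) := by
  rw [apply_aeval_eq_mapCoeffs_add hd, hdt, mul_zero, add_zero]

variable [CharZero L]

theorem parameterDerivation_mem_regularAt (hδ : δ t = 1)
    (hd : ∀ a : L, d (algebraMap L K a) = algebraMap L K a′) (hdt : d t = 0) (hq : Irreducible q)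
    {x : K} (hx : x ∈ regularAt hδ hq) : d x ∈ regularAt hδ hq := by
  obtain ⟨a, b, hb, rfl⟩ := hx
  refine ⟨b * mapCoeffs a - a * mapCoeffs b, b ^ 2, fun h => hb (hq.prime.dvd_of_dvd_pow h), ?_⟩
  rw [Derivation.leibniz_div, apply_aeval_eq_mapCoeffs hd hdt, apply_aeval_eq_mapCoeffs hd hdt]
  simp only [map_sub, map_mul, map_pow, smul_eq_mul]
  rw [inv_pow, div_eq_inv_mul]

/-- The residue along `q` is constant: if `B` has at most a simple pole along `q`, with polar part
`p / q` modulo exact elements, and if the derivative of `B` in the direction of the parameters is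
exact, then `p / q` is a constant multiple of `q' / q`, up to a polynomial. -/
theorem exists_eq_const_mul_logDeriv_add [IsAlgClosed k]
    (hconst : ∀ a : L, a′ = 0 → a ∈ Set.range (algebraMap k L)) (hδ : δ t = 1)
    (hfrac : ∀ x : K, ∃ p q : L[X], q ≠ 0 ∧ x = aeval t p / aeval t q)
    (hd : ∀ a : L, d (algebraMap L K a) = algebraMap L K a′) (hdt : d t = 0)
    (hcomm : ∀ x, d (δ x) = δ (d x)) (hq : Irreducible q) {A R₀ S : K} {p : L[X]}
    (hS : S ∈ regularAt hδ hq) (h : d (δ R₀ + aeval t p / aeval t q + S) = δ A) :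
    ∃ (κ : k) (a : L[X]), aeval t p / aeval t q =
      algebraMap k K κ * ((aeval t q)⁻¹ * δ (aeval t q)) + aeval t a := by
  have hq0 := aeval_ne_zero hδ hq.ne_zero
  obtain ⟨a, b, hab⟩ := isCoprime_derivative hq
  -- `w` extends the parameter derivation to `L[X]/(q)`, and `c` is the residue along `q`
  set w : L[X] := -(b * mapCoeffs q)
  set c : L[X] := b * p
  have hw' : mapCoeffs q = q * (a * mapCoeffs q) - w * derivative q := by
    simp only [w]
    linear_combination (-mapCoeffs q) * hab
  have hw : implicitDeriv w q = q * (a * mapCoeffs q) := by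
    have : implicitDeriv w q = mapCoeffs q + w * derivative q := by
      simp [implicitDeriv]
    rw [this]
    linear_combination hw'
  have hp : p = c * derivative q + a * p * q := by
    simp only [c]
    linear_combination (-p) * hab
  have hpq : aeval t p / aeval t q = aeval t c * (δ (aeval t q) / aeval t q) + aeval t (a * p) := by
    rw [apply_aeval hδ]
    conv_lhs => rw [hp]
    simp only [map_add, map_mul]
    field_simp
  have hc : implicitDeriv w c = mapCoeffs c + w * derivative c := by
    simp [implicitDeriv]
  -- modulo exact and regular elements, the derivative of `c q' / q` is `D c q' / q`
  have key : d (aeval t p / aeval t q) = aeval t (implicitDeriv w c * derivative q) / aeval t q +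
      δ (aeval t c * (d (aeval t q) / aeval t q)) +
      aeval t (mapCoeffs (a * p) - derivative c * (a * mapCoeffs q)) := by
    have e1 := congrArg (aeval t : L[X] → K) hw'
    rw [hpq, map_add, apply_aeval_eq_mapCoeffs hd hdt (a * p), Derivation.leibniz,
      Derivation.leibniz_div, hcomm, Derivation.leibniz δ, Derivation.leibniz_div,
      apply_aeval hδ q, apply_aeval hδ c, apply_aeval_eq_mapCoeffs hd hdt c,
      apply_aeval_eq_mapCoeffs hd hdt q, hc]
    simp only [map_add, map_sub, map_mul, smul_eq_mul] at e1 ⊢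
    field_simp
    linear_combination (-(aeval t q * aeval t (derivative c))) * e1
  have h1 : q ∣ implicitDeriv w c * derivative q := by
    refine dvd_of_apply_sub_div_mem_regularAt hδ hq hfrac
      (A := A - d R₀ - aeval t c * (d (aeval t q) / aeval t q)) ?_
    have h2 : d S + aeval t (mapCoeffs (a * p) - derivative c * (a * mapCoeffs q)) ∈
        regularAt hδ hq :=
      add_mem (parameterDerivation_mem_regularAt hδ hd hdt hq hS) (aeval_mem_regularAt hδ hq _)
    convert h2 using 1
    rw [map_add, map_add, key, hcomm] at h
    rw [map_sub, map_sub, ← h]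
    ring
  obtain ⟨κ, e, he⟩ := exists_dvd_sub_of_dvd_implicitDeriv hconst hq (Dvd.intro _ hw.symm)
    ((hq.prime.dvd_or_dvd h1).resolve_right (not_dvd_derivative hq))
  refine ⟨κ, e * derivative q + a * p, ?_⟩
  have he' := congrArg (aeval t : L[X] → K) he
  rw [hpq, apply_aeval hδ, IsScalarTower.algebraMap_apply k L K]
  simp only [map_add, map_sub, map_mul, Polynomial.aeval_C] at he' ⊢
  field_simp
  linear_combination aeval t (derivative q) * he'

/-- If the derivative of `B ∈ L(t)` in the direction of the parameters in `L` is exact, then `B` is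
the sum of an exact element and of a combination of logarithmic derivatives with constant
coefficients. -/
theorem mem_logExact_of_parameterDerivation_exact [IsAlgClosed k]
    (hconst : ∀ a : L, a′ = 0 → a ∈ Set.range (algebraMap k L)) (hδ : δ t = 1)
    (hfrac : ∀ x : K, ∃ p q : L[X], q ≠ 0 ∧ x = aeval t p / aeval t q)
    (hd : ∀ a : L, d (algebraMap L K a) = algebraMap L K a′) (hdt : d t = 0)
    (hcomm : ∀ x, d (δ x) = δ (d x)) {A B : K} (h : d B = δ A) :
    B ∈ logExact (δ.restrictScalars k) := by
  classical
  obtain ⟨p, q, hq, hB⟩ := hfrac B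
  obtain ⟨R₀, P, hP, hBP⟩ : IsHermiteReduced δ t B := hB ▸ isHermiteReduced_of_frac hδ q hq p
  rw [hBP]
  refine add_mem (apply_mem_logExact (δ.restrictScalars k) R₀) (sum_mem fun q hq => ?_)
  have hrest : ∑ r ∈ P.support.erase q, aeval t (P r) / aeval t r ∈
      regularAt hδ (hP q hq).2 := by
    refine sum_mem fun r hr => aeval_div_mem_regularAt hδ _ _ fun hdvd => ?_
    obtain ⟨hrq, hr⟩ := Finset.mem_erase.1 hr
    exact hrq (Polynomial.eq_of_monic_of_associated (hP r hr).1 (hP q hq).1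
      (((hP q hq).2.associated_of_dvd (hP r hr).2 hdvd).symm))
  obtain ⟨κ, a, ha⟩ := exists_eq_const_mul_logDeriv_add (A := A) (R₀ := R₀) (p := P q)
    hconst hδ hfrac hd hdt hcomm (hP q hq).2 hrest (by
      rw [add_assoc, Finset.add_sum_erase _ (fun r => aeval t (P r) / aeval t r) hq, ← h, hBP]
      rfl)
  obtain ⟨a, rfl⟩ := exists_derivative_eq a
  change aeval t (P q) / aeval t q ∈ _
  rw [ha, ← apply_aeval hδ, ← Algebra.smul_def]
  exact add_mem (Submodule.smul_mem _ _ (inv_smul_apply_mem_logExact (δ.restrictScalars k)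
    (aeval_ne_zero hδ (hP q hq).2.ne_zero))) (apply_mem_logExact (δ.restrictScalars k) _)

end Residues

/-! ### Closed differentials of a rational function field in two variables -/

section TwoVariables

open scoped Polynomial IntermediateField
open Polynomial (aeval derivative)
open KaehlerDifferential (D)

variable {k K M : Type*} [Field k] [Field K] [Algebra k K] [AddCommGroup M] [Module k M]
  [Module K M]

/-- The restriction of a derivation to a stable subfield. -/
def restrictDerivation (L : IntermediateField k K) (d : Derivation k K K)
    (h : ∀ x ∈ L, d x ∈ L) : Derivation k L L :=
  Derivation.mk' (d.toLinearMap.restrict (p := L.toSubmodule) (q := L.toSubmodule) h)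
    fun a b => Subtype.ext (d.leibniz a b)

/-- A derivation that vanishes on a subfield is linear over it. -/
def extendConstants (L : IntermediateField k K) (d : Derivation k K K)
    (h : ∀ x ∈ L, d x = 0) : Derivation L K K :=
  Derivation.mk'
    { toFun := d
      map_add' := d.map_add
      map_smul' := fun a x => by
        simp [Algebra.smul_def, h a a.2] }
    d.leibniz

theorem derivation_eq_zero_of_mem_adjoin {E : Derivation k K M} {s x : K} (hs : E s = 0)
    (hx : x ∈ k⟮s⟯) : E x = 0 := by
  induction hx using IntermediateField.adjoin_induction with
  | mem x hx => rwa [Set.mem_singleton_iff.1 hx]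
  | algebraMap c => exact E.map_algebraMap c
  | add x y _ _ hx hy => rw [map_add, hx, hy, add_zero]
  | inv x _ hx => rw [Derivation.leibniz_inv, hx, smul_zero]
  | mul x y _ _ hx hy => rw [Derivation.leibniz, hx, hy, smul_zero, smul_zero, add_zero]

theorem derivation_eq_zero {E : Derivation k K M} {s t : K} (hs : E s = 0) (ht : E t = 0)
    (hfrac : ∀ x : K, ∃ p q : k⟮s⟯[X], q ≠ 0 ∧ x = aeval t p / aeval t q) (x : K) : E x = 0 := by
  have hpoly : ∀ p : k⟮s⟯[X], E (aeval t p) = 0 := fun p => by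
    induction p using Polynomial.induction_on' with
    | add p q hp hq => rw [map_add, map_add, hp, hq, add_zero]
    | monomial n a =>
      rw [Polynomial.aeval_monomial, Derivation.leibniz, Derivation.leibniz_pow, ht, smul_zero,
        smul_zero, smul_zero, zero_add]
      exact (congrArg _ (derivation_eq_zero_of_mem_adjoin hs a.2)).trans (smul_zero _)
  obtain ⟨p, q, -, rfl⟩ := hfrac x
  rw [Derivation.leibniz_div, hpoly, hpoly, smul_zero, smul_zero, sub_zero, smul_zero]

variable {s t : K} {Ds Dt : Derivation k K K}

/-- The differentials `ds` and `dt` of coordinates generate the module of differentials. -/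
theorem eq_contraction_smul_add (hss : Ds s = 1) (hst : Ds t = 0) (hts : Dt s = 0) (htt : Dt t = 1)
    (hfrac : ∀ x : K, ∃ p q : k⟮s⟯[X], q ≠ 0 ∧ x = aeval t p / aeval t q) (ω : Ω[K⁄k]) :
    ω = Ds.liftKaehlerDifferential ω • D k K s + Dt.liftKaehlerDifferential ω • D k K t := by
  have h : (LinearMap.id : Ω[K⁄k] →ₗ[K] Ω[K⁄k]) =
      Ds.liftKaehlerDifferential.smulRight (D k K s) +
        Dt.liftKaehlerDifferential.smulRight (D k K t) := by
    apply Derivation.liftKaehlerDifferential_unique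
    rw [← sub_eq_zero]
    ext x
    refine derivation_eq_zero (E := _) ?_ ?_ hfrac x <;>
      simp [Derivation.liftKaehlerDifferential_comp_D, hss, hst, hts, htt]
  exact LinearMap.congr_fun h ω

theorem eq_of_contraction_eq (hss : Ds s = 1) (hst : Ds t = 0) (hts : Dt s = 0) (htt : Dt t = 1)
    (hfrac : ∀ x : K, ∃ p q : k⟮s⟯[X], q ≠ 0 ∧ x = aeval t p / aeval t q) {ω η : Ω[K⁄k]}
    (h₁ : Ds.liftKaehlerDifferential ω = Ds.liftKaehlerDifferential η)
    (h₂ : Dt.liftKaehlerDifferential ω = Dt.liftKaehlerDifferential η) : ω = η := by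
  rw [eq_contraction_smul_add hss hst hts htt hfrac ω, h₁, h₂,
    ← eq_contraction_smul_add hss hst hts htt hfrac η]

theorem exists_mem_logExact_contraction_eq {d : Derivation k K K} {B : K}
    (hB : B ∈ logExact d) : ∃ η ∈ logExact (D k K), d.liftKaehlerDifferential η = B := by
  induction hB using logExact_induction with
  | exact G => exact ⟨_, apply_mem_logExact _ G, d.liftKaehlerDifferential_comp_D G⟩
  | log F hF =>
    exact ⟨_, inv_smul_apply_mem_logExact _ hF, by
      rw [map_smul, d.liftKaehlerDifferential_comp_D]⟩
  | add x y _ _ hx hy =>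
    obtain ⟨η, hη, rfl⟩ := hx
    obtain ⟨θ, hθ, rfl⟩ := hy
    exact ⟨η + θ, add_mem hη hθ, map_add _ _ _⟩
  | smul c x _ hx =>
    obtain ⟨η, hη, rfl⟩ := hx
    exact ⟨c • η, Submodule.smul_mem _ c hη, LinearMap.map_smul_of_tower _ c η⟩

theorem contraction_comm_of_mem_logExact (hcomm : ∀ x, Ds (Dt x) = Dt (Ds x)) {η : Ω[K⁄k]}
    (hη : η ∈ logExact (D k K)) :
    Ds (Dt.liftKaehlerDifferential η) = Dt (Ds.liftKaehlerDifferential η) := by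
  induction hη using logExact_induction with
  | exact G => simp only [Derivation.liftKaehlerDifferential_comp_D, hcomm]
  | log F hF =>
    simp only [map_smul, Derivation.liftKaehlerDifferential_comp_D, smul_eq_mul,
      Derivation.leibniz, Derivation.leibniz_inv, hcomm]
    ring
  | add x y _ _ hx hy => simp only [map_add, hx, hy]
  | smul c x _ hx =>
    rw [LinearMap.map_smul_of_tower, LinearMap.map_smul_of_tower, Derivation.map_smul,
      Derivation.map_smul, hx]

/-- A closed differential of `k(s, t)`, with `k` algebraically closed of characteristic zero, is a
combination of logarithmic differentials and an exact differential: its `dt`-component is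
integrated over `k(s)`, and the remaining `A(s) ds` over `k`. -/
theorem mem_logExact_of_contraction_comm [IsAlgClosed k] [CharZero k] (hss : Ds s = 1)
    (hst : Ds t = 0) (hts : Dt s = 0) (htt : Dt t = 1)
    (hcomm : ∀ x, Ds (Dt x) = Dt (Ds x))
    (hfrac : ∀ x : K, ∃ p q : k⟮s⟯[X], q ≠ 0 ∧ x = aeval t p / aeval t q) {ω : Ω[K⁄k]}
    (hω : Ds (Dt.liftKaehlerDifferential ω) = Dt (Ds.liftKaehlerDifferential ω)) :
    ω ∈ logExact (D k K) := by
  have hDtL : ∀ x ∈ k⟮s⟯, Dt x = 0 := fun x hx => derivation_eq_zero_of_mem_adjoin hts hx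
  have hDsL : ∀ x ∈ k⟮s⟯, Ds x ∈ k⟮s⟯ := fun x hx => by
    induction hx using IntermediateField.adjoin_induction with
    | mem x hx =>
      rw [Set.mem_singleton_iff.1 hx, hss]
      exact one_mem _
    | algebraMap c =>
      rw [Derivation.map_algebraMap]
      exact zero_mem _
    | add x y _ _ hx hy =>
      rw [map_add]
      exact add_mem hx hy
    | inv x hx' hx =>
      rw [Derivation.leibniz_inv]
      exact mul_mem (neg_mem (pow_mem (inv_mem hx') _)) hx
    | mul x y hx' hy' hx hy =>
      rw [Derivation.leibniz]
      exact add_mem (mul_mem hx' hy) (mul_mem hy' hx)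
  have : CharZero k⟮s⟯ := charZero_of_injective_algebraMap (algebraMap k k⟮s⟯).injective
  set d := restrictDerivation k⟮s⟯ Ds hDsL with hd
  set s₀ : k⟮s⟯ := IntermediateField.AdjoinSimple.gen k s with hs₀
  have hds : d s₀ = 1 := Subtype.ext hss
  have hfrac₀ : ∀ x : k⟮s⟯, ∃ p q : k[X], q ≠ 0 ∧ x = aeval s₀ p / aeval s₀ q := by
    intro x
    obtain ⟨p, q, hpq⟩ := (IntermediateField.mem_adjoin_simple_iff k (x : K)).1 x.2
    have hx : x = aeval s₀ p / aeval s₀ q := by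
      apply Subtype.ext
      rw [hpq]
      have h (p : k[X]) : ((aeval s₀ p : k⟮s⟯) : K) = aeval s p :=
        (Polynomial.aeval_algHom_apply k⟮s⟯.val s₀ p).symm
      push_cast
      rw [h, h]
    rcases eq_or_ne q 0 with rfl | hq
    · exact ⟨0, 1, one_ne_zero, by simpa using hx⟩
    · exact ⟨p, q, hq, hx⟩
  set δ := extendConstants k⟮s⟯ Dt hDtL with hδ
  obtain ⟨η, hη, hηω⟩ : ∃ η ∈ logExact (D k K),
      Dt.liftKaehlerDifferential η = Dt.liftKaehlerDifferential ω := by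
    let _ : Differential k⟮s⟯ := ⟨d.restrictScalars ℤ⟩
    refine exists_mem_logExact_contraction_eq ?_
    exact mem_logExact_of_parameterDerivation_exact (k := k) (δ := δ) (d := Ds)
      (fun a ha => mem_range_of_apply_eq_zero hds hfrac₀ ha) htt hfrac (fun a => rfl) hst hcomm hω
  -- the remaining form has no `dt`-component, so it is `A ds` with `A ∈ k(s)`
  obtain ⟨A, hA⟩ : Ds.liftKaehlerDifferential (ω - η) ∈ Set.range (algebraMap k⟮s⟯ K) := by
    refine mem_range_of_apply_eq_zero (δ := δ) htt hfrac ?_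
    change Dt _ = 0
    rw [map_sub, map_sub, ← hω, ← contraction_comm_of_mem_logExact hcomm hη, hηω, sub_self]
  have hA' : A ∈ logExact d := by
    let _ : Differential k := ⟨0⟩
    exact mem_logExact_of_parameterDerivation_exact (k := k) (δ := d)
      (d := (0 : Derivation k k⟮s⟯ k⟮s⟯)) (A := 0) (fun a _ => ⟨a, rfl⟩) hds hfrac₀
      (fun a => (map_zero _).symm) rfl (fun x => (map_zero _).symm) (map_zero _).symm
  obtain ⟨θ, hθ, hθA, hθ0⟩ : ∃ θ ∈ logExact (D k K),
      Ds.liftKaehlerDifferential θ = A ∧ Dt.liftKaehlerDifferential θ = 0 := by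
    clear hA
    induction hA' using logExact_induction with
    | exact G =>
      exact ⟨_, apply_mem_logExact _ (G : K), Ds.liftKaehlerDifferential_comp_D _, by
        rw [Dt.liftKaehlerDifferential_comp_D, hDtL _ G.2]⟩
    | log F hF =>
      refine ⟨_, inv_smul_apply_mem_logExact (D k K) (F := (F : K)) (by simpa using hF), ?_, ?_⟩
      · rw [map_smul, Ds.liftKaehlerDifferential_comp_D]
        rfl
      · rw [map_smul, Dt.liftKaehlerDifferential_comp_D, hDtL _ F.2, smul_zero]
    | add x y _ _ hx hy =>
      obtain ⟨η, hη, hη1, hη2⟩ := hx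
      obtain ⟨θ, hθ, hθ1, hθ2⟩ := hy
      exact ⟨η + θ, add_mem hη hθ, by rw [map_add, hη1, hθ1]; rfl, by
        rw [map_add, hη2, hθ2, add_zero]⟩
    | smul c x _ hx =>
      obtain ⟨η, hη, hη1, hη2⟩ := hx
      exact ⟨c • η, Submodule.smul_mem _ c hη, by rw [LinearMap.map_smul_of_tower, hη1]; rfl, by
        rw [LinearMap.map_smul_of_tower, hη2, smul_zero]⟩
  have hωηθ : ω = η + θ := by
    refine eq_of_contraction_eq hss hst hts htt hfrac ?_ ?_
    · rw [map_add, hθA, ← sub_eq_iff_eq_add', ← map_sub, ← hA]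
      rfl
    · rw [map_add, hθ0, hηω, add_zero]
  rw [hωηθ]
  exact add_mem hη hθ

end TwoVariables

/-! ### Derivations of the function fields of affine space and of the plane -/

section FunctionFields

open scoped Polynomial IntermediateField
open KaehlerDifferential (D)

/-- The extension of a derivation of the polynomial ring to its field of fractions. -/
def fracDerivation (d : Derivation ℂ Poly Poly) : Derivation ℂ RatC3 RatC3 :=
  (LinearMap.extendScalarsOfIsLocalization (nonZeroDivisors Poly) RatC3
    (IsLocalizedModule.lift (nonZeroDivisors Poly) (KaehlerDifferential.map ℂ ℂ Poly RatC3)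
      (Algebra.linearMap Poly RatC3 ∘ₗ d.liftKaehlerDifferential)
      (IsLocalizedModule.map_units (Algebra.linearMap Poly RatC3)))).compDer (D ℂ RatC3)

@[simp]
theorem fracDerivation_toRat (d : Derivation ℂ Poly Poly) (p : Poly) :
    fracDerivation d (toRat p) = toRat (d p) := by
  have h := IsLocalizedModule.lift_apply (nonZeroDivisors Poly)
    (KaehlerDifferential.map ℂ ℂ Poly RatC3) (Algebra.linearMap Poly RatC3 ∘ₗ
      d.liftKaehlerDifferential) (IsLocalizedModule.map_units (Algebra.linearMap Poly RatC3))
    (D ℂ Poly p)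
  rw [KaehlerDifferential.map_D] at h
  refine h.trans ?_
  simp [Derivation.liftKaehlerDifferential_comp_D]

/-- The partial derivatives of rational functions on `ℂ³`. -/
def ratPderiv (i : Fin 3) : Derivation ℂ RatC3 RatC3 := fracDerivation (pderiv i)

@[simp]
theorem ratPderiv_toRat (i : Fin 3) (p : Poly) : ratPderiv i (toRat p) = toRat (pderiv i p) :=
  fracDerivation_toRat _ p

theorem toRat_ne_zero {p : Poly} (hp : p ≠ 0) : toRat p ≠ 0 := by simpa using hp

theorem ratC3_derivation_ext {M : Type*} [AddCommGroup M] [Module ℂ M] [Module RatC3 M]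
    {d e : Derivation ℂ RatC3 M} (h : ∀ p, d (toRat p) = e (toRat p)) : d = e := by
  ext a
  obtain ⟨p, q, -, rfl⟩ := IsFractionRing.div_surjective (A := Poly) a
  rw [Derivation.leibniz_div, Derivation.leibniz_div, h, h]

theorem pderiv_comm (i j : Fin 3) (p : Poly) : pderiv i (pderiv j p) = pderiv j (pderiv i p) := by
  have h : ⁅(pderiv i : Derivation ℂ Poly Poly), (pderiv j : Derivation ℂ Poly Poly)⁆ = 0 := by
    apply MvPolynomial.derivation_ext
    intro l
    rw [Derivation.commutator_apply]
    simp only [pderiv_X, Derivation.zero_apply]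
    rw [Pi.single_apply, Pi.single_apply]
    split_ifs <;> simp
  have := Derivation.congr_fun h p
  rwa [Derivation.commutator_apply, Derivation.zero_apply, sub_eq_zero] at this

theorem isHomogeneous_X_mul_pderiv {p : Poly} {d : ℕ} (hp : p.IsHomogeneous d) (i j : Fin 3) :
    (X i * pderiv j p).IsHomogeneous d := by
  rcases Nat.eq_zero_or_pos d with rfl | hd
  · rw [← totalDegree_zero_iff_isHomogeneous, totalDegree_eq_zero_iff_eq_C] at hp
    rw [hp, pderiv_C, mul_zero]
    exact isHomogeneous_zero _ _ _
  · have := (isHomogeneous_X ℂ i).mul (hp.pderiv (i := j))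
    rwa [Nat.add_sub_cancel' hd] at this

/-- The vector field `x₀ ∂ⱼ` on `ℂ³`, which descends to the plane. -/
def scaledPderiv (j : Fin 3) : Derivation ℂ RatC3 RatC3 := toRat (X 0) • ratPderiv j

theorem scaledPderiv_div (j : Fin 3) {u v : Poly} (hv : v ≠ 0) :
    scaledPderiv j (toRat u / toRat v) =
      toRat (v * (X 0 * pderiv j u) - u * (X 0 * pderiv j v)) / toRat (v ^ 2) := by
  have := toRat_ne_zero hv
  simp only [scaledPderiv, Derivation.smul_apply, Derivation.leibniz_div, ratPderiv_toRat,
    smul_eq_mul, map_sub, map_mul, map_pow]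
  field_simp

theorem scaledPderiv_mem (j : Fin 3) {a : RatC3} (ha : a ∈ FunField) :
    scaledPderiv j a ∈ FunField := by
  obtain ⟨d, u, v, hu, hv, h0, rfl⟩ := ha
  refine ⟨d + d, v * (X 0 * pderiv j u) - u * (X 0 * pderiv j v), v ^ 2,
    (hv.mul (isHomogeneous_X_mul_pderiv hu 0 j)).sub (hu.mul (isHomogeneous_X_mul_pderiv hv 0 j)),
    ?_, pow_ne_zero 2 h0, scaledPderiv_div j h0⟩
  rw [sq]
  exact hv.mul hv

/-- The vector field on the plane induced by `x₀ ∂ⱼ`; in the affine coordinates `x₁ / x₀`,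
`x₂ / x₀`, these are the partial derivatives. -/
def planeDerivation (j : Fin 3) : Derivation ℂ FunField FunField :=
  restrictDerivation FunField (scaledPderiv j) fun _ => scaledPderiv_mem j

@[simp]
theorem coe_planeDerivation (j : Fin 3) (a : FunField) :
    (planeDerivation j a : RatC3) = scaledPderiv j a := rfl

/-- The quotient of homogeneous polynomials of the same degree as a rational function on the
plane. -/
def quot {d : ℕ} {u v : Poly} (hu : u.IsHomogeneous d) (hv : v.IsHomogeneous d) (h0 : v ≠ 0) :
    FunField := ⟨toRat u / toRat v, d, u, v, hu, hv, h0, rfl⟩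

@[simp]
theorem coe_quot {d : ℕ} {u v : Poly} (hu : u.IsHomogeneous d) (hv : v.IsHomogeneous d)
    (h0 : v ≠ 0) : (quot hu hv h0 : RatC3) = toRat u / toRat v := rfl

/-- The affine coordinate `xᵢ / x₀` on the plane. -/
def affineCoord (i : Fin 3) : FunField :=
  quot (isHomogeneous_X ℂ i) (isHomogeneous_X ℂ 0) (X_ne_zero 0)

theorem planeDerivation_affineCoord {i j : Fin 3} (hj : j ≠ 0) :
    planeDerivation j (affineCoord i) = if i = j then 1 else 0 := by
  apply Subtype.ext
  have h0 : toRat (X 0) ≠ 0 := toRat_ne_zero (X_ne_zero 0)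
  rw [coe_planeDerivation, affineCoord, coe_quot, scaledPderiv_div j (X_ne_zero 0)]
  rw [pderiv_X_of_ne hj.symm]
  split_ifs with h
  · subst h
    rw [pderiv_X_self]
    simp only [map_sub, map_mul, map_pow, map_one, map_zero]
    push_cast
    field_simp
    ring
  · rw [pderiv_X_of_ne h]
    simp

theorem scaledPderiv_comm {i j : Fin 3} (hi : i ≠ 0) (hj : j ≠ 0) :
    ⁅scaledPderiv i, scaledPderiv j⁆ = 0 := by
  apply ratC3_derivation_ext
  intro p
  rw [Derivation.commutator_apply]
  simp only [scaledPderiv, Derivation.smul_apply, ratPderiv_toRat, smul_eq_mul, ← map_mul,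
    pderiv_mul, pderiv_X_of_ne hi.symm, pderiv_X_of_ne hj.symm, Derivation.zero_apply]
  rw [pderiv_comm, zero_mul, zero_add, zero_mul, zero_add, sub_self]

theorem planeDerivation_comm {i j : Fin 3} (hi : i ≠ 0) (hj : j ≠ 0) :
    ⁅planeDerivation i, planeDerivation j⁆ = 0 := by
  ext a
  have := Derivation.congr_fun (scaledPderiv_comm hi hj) (a : RatC3)
  rw [Derivation.commutator_apply] at this ⊢
  exact this

/-- A homogeneous polynomial in affine coordinates. -/
theorem toRat_eq_pow_mul_aeval {d : ℕ} {u : Poly} (hu : u.IsHomogeneous d) :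
    toRat u = toRat (X 0) ^ d * (aeval affineCoord u : FunField) := by
  have h0 : toRat (X 0) ≠ 0 := toRat_ne_zero (X_ne_zero 0)
  have h1 : ((aeval affineCoord u : FunField) : RatC3) =
      aeval (fun i => toRat (X i) / toRat (X 0)) u :=
    MvPolynomial.comp_aeval_apply (f := affineCoord) FunField.val u
  have h2 : toRat u = aeval (fun i => toRat (X i)) u := by
    have := MvPolynomial.comp_aeval_apply (f := fun i => (X i : Poly))
      (IsScalarTower.toAlgHom ℂ Poly RatC3) u
    rw [aeval_X_left_apply] at this
    exact this
  rw [h1, h2, aeval_def, aeval_def, eval₂_eq', eval₂_eq', Finset.mul_sum]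
  refine Finset.sum_congr rfl fun m hm => ?_
  have hdeg : ∑ i, m i = d := by
    have := hu.degree_eq_sum_deg_support hm
    rw [this]
    exact (Finset.sum_subset (Finset.subset_univ _) fun i _ hi =>
      Finsupp.notMem_support_iff.1 hi).symm
  simp only [div_pow, Finset.prod_div_distrib, Finset.prod_pow_eq_pow_sum, hdeg]
  field_simp

theorem funField_eq_div (a : FunField) : ∃ p q : ℂ⟮affineCoord 1⟯[X], q ≠ 0 ∧
    a = Polynomial.aeval (affineCoord 2) p / Polynomial.aeval (affineCoord 2) q := by
  obtain ⟨a, d, u, v, hu, hv, h0, rfl⟩ := a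
  have h0' : toRat (X 0) ≠ 0 := toRat_ne_zero (X_ne_zero 0)
  set y : Fin 3 → ℂ⟮affineCoord 1⟯[X] :=
    ![1, Polynomial.C (IntermediateField.AdjoinSimple.gen ℂ (affineCoord 1)), Polynomial.X]
  have hy : (fun i => Polynomial.aeval (affineCoord 2) (y i)) = affineCoord := by
    funext i
    fin_cases i
    · simp only [y, Fin.zero_eta, Matrix.cons_val_zero, map_one]
      apply Subtype.ext
      rw [affineCoord, coe_quot, div_self h0']
      rfl
    · simp [y]
    · simp [y]
  have hw (w : Poly) : Polynomial.aeval (affineCoord 2) (aeval y w) = aeval affineCoord w := by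
    have := MvPolynomial.comp_aeval_apply (f := y)
      ((Polynomial.aeval (R := ℂ⟮affineCoord 1⟯) (affineCoord 2)).restrictScalars ℂ) w
    exact this.trans (congrArg (fun f : Fin 3 → FunField => aeval f w) hy)
  refine ⟨aeval y u, aeval y v, fun h => ?_, ?_⟩
  · apply toRat_ne_zero h0
    rw [toRat_eq_pow_mul_aeval hv, ← hw, h]
    simp
  · apply Subtype.ext
    rw [hw, hw]
    push_cast
    change toRat u / toRat v = _
    rw [toRat_eq_pow_mul_aeval hu, toRat_eq_pow_mul_aeval hv,
      mul_div_mul_left _ _ (pow_ne_zero d h0')]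

theorem lift_D (a : FunField) : lift (D ℂ FunField a) = D ℂ RatC3 (a : RatC3) :=
  KaehlerDifferential.map_D ℂ ℂ FunField RatC3 a

theorem lift_add (ω η : RatForm) : lift (ω + η) = lift ω + lift η := map_add _ _ _

theorem lift_smul (a : FunField) (ω : RatForm) : lift (a • ω) = (a : RatC3) • lift ω :=
  map_smul (KaehlerDifferential.map ℂ ℂ FunField RatC3) a ω

theorem lift_smul_complex (c : ℂ) (ω : RatForm) : lift (c • ω) = c • lift ω :=
  LinearMap.map_smul_of_tower (KaehlerDifferential.map ℂ ℂ FunField RatC3) c ω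

theorem lift_sum {ι : Type*} (s : Finset ι) (ω : ι → RatForm) :
    lift (∑ i ∈ s, ω i) = ∑ i ∈ s, lift (ω i) := map_sum _ _ _

theorem contraction_lift (j : Fin 3) (ω : RatForm) :
    (scaledPderiv j).liftKaehlerDifferential (lift ω) =
      ((planeDerivation j).liftKaehlerDifferential ω : RatC3) := by
  have h : ω ∈ Submodule.span FunField (Set.range (D ℂ FunField)) := by
    rw [KaehlerDifferential.span_range_derivation]
    trivial
  induction h using Submodule.span_induction with
  | mem x hx =>
    obtain ⟨a, rfl⟩ := hx
    rw [lift_D, Derivation.liftKaehlerDifferential_comp_D,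
      Derivation.liftKaehlerDifferential_comp_D, coe_planeDerivation]
  | zero => simp [lift]
  | add x y _ _ hx hy => rw [lift_add, map_add, map_add, hx, hy]; rfl
  | smul a x _ hx => rw [lift_smul, map_smul, map_smul, hx]; rfl

/-- The lift of rational `1`-forms from the plane to `ℂ³` is injective. -/
theorem lift_injective : Function.Injective lift := fun ω η h => by
  refine eq_of_contraction_eq (s := affineCoord 1) (t := affineCoord 2) (Ds := planeDerivation 1)
    (Dt := planeDerivation 2) ?_ ?_ ?_ ?_ funField_eq_div ?_ ?_
  · simp [planeDerivation_affineCoord]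
  · simp [planeDerivation_affineCoord]
  · simp [planeDerivation_affineCoord]
  · simp [planeDerivation_affineCoord]
  · exact Subtype.ext (by rw [← contraction_lift, h, contraction_lift])
  · exact Subtype.ext (by rw [← contraction_lift, h, contraction_lift])

theorem ClosedForm.mem_logExact {ω : RatForm} (hω : ClosedForm ω) :
    ω ∈ logExact (D ℂ FunField) := by
  have hc : ⁅planeDerivation 1, planeDerivation 2⁆ = 0 :=
    planeDerivation_comm one_ne_zero (by decide)
  refine mem_logExact_of_contraction_comm (s := affineCoord 1) (t := affineCoord 2)
    (Ds := planeDerivation 1) (Dt := planeDerivation 2) ?_ ?_ ?_ ?_ ?_ funField_eq_div ?_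
  · simp [planeDerivation_affineCoord]
  · simp [planeDerivation_affineCoord]
  · simp [planeDerivation_affineCoord]
  · simp [planeDerivation_affineCoord]
  · intro x
    have := Derivation.congr_fun hc x
    rwa [Derivation.commutator_apply, Derivation.zero_apply, sub_eq_zero] at this
  · have h := hω (planeDerivation 1) (planeDerivation 2)
    have h0 : (0 : Derivation ℂ FunField FunField).liftKaehlerDifferential = 0 :=
      Derivation.liftKaehlerDifferential_unique _ _ (by
        rw [Derivation.liftKaehlerDifferential_comp]
        rfl)
    rwa [hc, h0, LinearMap.zero_apply, sub_zero, sub_eq_zero] at h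

end FunctionFields

/-! ### Factorization of homogeneous polynomials -/

section Homogeneous

open scoped Polynomial
open KaehlerDifferential (D)

/-- The polynomial `p(T x)` in the new variable `T`; its coefficients are the homogeneous components
of `p`. -/
def rescale : Poly →ₐ[ℂ] Poly[X] := aeval fun i => Polynomial.C (X i) * Polynomial.X

theorem rescale_of_isHomogeneous {p : Poly} {d : ℕ} (hp : p.IsHomogeneous d) :
    rescale p = Polynomial.monomial d p := by
  have h : p = ∑ m ∈ p.support, monomial m (p.coeff m) := p.as_sum
  conv_lhs => rw [h]
  conv_rhs => rw [h]
  rw [map_sum, map_sum]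
  refine Finset.sum_congr rfl fun m hm => ?_
  have hdeg : m.sum (fun _ e => e) = d := (hp.degree_eq_sum_deg_support hm).symm
  rw [rescale, aeval_monomial, ← Polynomial.C_mul_X_pow_eq_monomial, monomial_eq, ← hdeg]
  simp only [Finsupp.prod, Finsupp.sum, mul_pow, Finset.prod_mul_distrib,
    Finset.prod_pow_eq_pow_sum, map_mul, map_prod, map_pow]
  rw [mul_assoc]
  rfl

theorem coeff_rescale (p : Poly) (n : ℕ) :
    (rescale p).coeff n = homogeneousComponent n p := by
  conv_lhs => rw [← sum_homogeneousComponent p]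
  rw [map_sum, Polynomial.finsetSum_coeff]
  simp only [rescale_of_isHomogeneous (homogeneousComponent_isHomogeneous _ p),
    Polynomial.coeff_monomial]
  rw [Finset.sum_ite_eq']
  split_ifs with h
  · rfl
  · rw [homogeneousComponent_eq_zero]
    simpa using h

/-- The factors of a homogeneous polynomial are homogeneous. -/
theorem isHomogeneous_of_dvd {p u : Poly} {d : ℕ} (hu : u.IsHomogeneous d) (h0 : u ≠ 0)
    (h : p ∣ u) : p.IsHomogeneous p.totalDegree := by
  obtain ⟨q, rfl⟩ := h
  have hp0 := left_ne_zero_of_mul h0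
  have hne : ∀ p : Poly, p ≠ 0 → rescale p ≠ 0 := fun p hp h => hp (by
    rw [← sum_homogeneousComponent p]
    exact Finset.sum_eq_zero fun n _ => by rw [← coeff_rescale, h, Polynomial.coeff_zero])
  have hp := hne p hp0
  have hq := hne q (right_ne_zero_of_mul h0)
  have hpq : rescale p * rescale q = Polynomial.monomial d (p * q) := by
    rw [← map_mul, rescale_of_isHomogeneous hu]
  have h1 := congrArg Polynomial.natDegree hpq
  have h2 := congrArg Polynomial.natTrailingDegree hpq
  rw [Polynomial.natDegree_mul hp hq, Polynomial.natDegree_monomial_eq _ h0] at h1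
  rw [Polynomial.natTrailingDegree_mul hp hq, Polynomial.natTrailingDegree_monomial h0] at h2
  have h3 := Polynomial.natTrailingDegree_le_natDegree (rescale p)
  have h4 := Polynomial.natTrailingDegree_le_natDegree (rescale q)
  have h5 : p = homogeneousComponent (rescale p).natDegree p := by
    conv_lhs => rw [← sum_homogeneousComponent p]
    refine Finset.sum_eq_single _ (fun n _ hn => ?_) (fun hn => ?_)
    · rw [← coeff_rescale]
      rcases lt_or_gt_of_ne hn with hn | hn
      · exact Polynomial.coeff_eq_zero_of_lt_natTrailingDegree (by omega)
      · exact Polynomial.coeff_eq_zero_of_natDegree_lt hn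
    · exact homogeneousComponent_eq_zero _ _ (by simpa using hn)
  have h6 : p.IsHomogeneous (rescale p).natDegree := by
    have h := homogeneousComponent_isHomogeneous (rescale p).natDegree p
    rwa [← h5] at h
  rwa [h6.totalDegree hp0]

/-- The irreducible homogeneous polynomials, one for each curve: a representative of every class of
associated polynomials is chosen. -/
def CurvePoly : Type :=
  {q : Poly // Irreducible q ∧ q.IsHomogeneous q.totalDegree ∧ Quot.out (Associates.mk q) = q}

namespace CurvePoly

theorem irreducible (q : CurvePoly) : Irreducible q.1 := q.2.1

theorem isHomogeneous (q : CurvePoly) : q.1.IsHomogeneous q.1.totalDegree := q.2.2.1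

theorem ne_zero (q : CurvePoly) : q.1 ≠ 0 := q.irreducible.ne_zero

theorem eq_of_associated {p q : CurvePoly} (h : Associated p.1 q.1) : p = q := by
  apply Subtype.ext
  rw [← p.2.2.2, ← q.2.2.2, Associates.mk_eq_mk_iff_associated.2 h]

theorem eq_of_dvd {p q : CurvePoly} (h : p.1 ∣ q.1) : p = q :=
  eq_of_associated (p.irreducible.associated_of_dvd q.irreducible h)

theorem exists_eq_C_mul {i : Poly} {d : ℕ} (hi : Irreducible i) (hd : i.IsHomogeneous d) :
    ∃ (q : CurvePoly) (a : ℂ), a ≠ 0 ∧ i = C a * q.1 := by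
  have h : Associated (Quot.out (Associates.mk i)) i :=
    Associates.mk_quot_out i
  refine ⟨⟨Quot.out (Associates.mk i), h.irreducible_iff.2 hi,
    isHomogeneous_of_dvd hd hi.ne_zero h.dvd, by rw [Associates.mk_eq_mk_iff_associated.2 h]⟩, ?_⟩
  obtain ⟨w, hw⟩ := h
  obtain ⟨a, ha, haw⟩ := MvPolynomial.isUnit_iff_eq_C_of_isReduced.1 w.isUnit
  exact ⟨a, ha.ne_zero, by rw [← haw, mul_comm, hw]⟩

end CurvePoly

theorem homogeneous_induction {P : Poly → Prop} (const : ∀ a : ℂ, a ≠ 0 → P (C a))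
    (mul : ∀ (q : CurvePoly) (u : Poly) (d : ℕ), u ≠ 0 → u.IsHomogeneous d → P u → P (q.1 * u))
    {u : Poly} {d : ℕ} (hu : u.IsHomogeneous d) (h0 : u ≠ 0) : P u := by
  suffices h : ∀ a : ℂ, a ≠ 0 → P (C a * u) by simpa using h 1 one_ne_zero
  induction u using WfDvdMonoid.induction_on_irreducible generalizing d with
  | zero => exact absurd rfl h0
  | unit u hunit =>
    intro a ha
    obtain ⟨b, hb, rfl⟩ := MvPolynomial.isUnit_iff_eq_C_of_isReduced.1 hunit
    rw [← map_mul]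
    exact const _ (mul_ne_zero ha hb.ne_zero)
  | mul u i hu0 hi ih =>
    intro a ha
    have hu' := isHomogeneous_of_dvd hu h0 (dvd_mul_left u i)
    obtain ⟨q, b, hb, rfl⟩ :=
      CurvePoly.exists_eq_C_mul hi (isHomogeneous_of_dvd hu h0 (dvd_mul_right i u))
    have hab : C a * (C b * q.1 * u) = q.1 * (C (a * b) * u) := by
      rw [map_mul]
      ring
    have hab0 := mul_ne_zero ha hb
    rw [hab]
    exact mul q _ _ (mul_ne_zero (by simpa using hab0) hu0) (hu'.C_mul _) (ih hu' hu0 _ hab0)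

/-- The product of powers of curve polynomials with given exponents. -/
def curveProd (m : CurvePoly →₀ ℕ) : Poly := m.prod fun q e => q.1 ^ e

theorem curveProd_ne_zero (m : CurvePoly →₀ ℕ) : curveProd m ≠ 0 :=
  Finset.prod_ne_zero_iff.2 fun q _ => pow_ne_zero _ q.ne_zero

theorem isHomogeneous_curveProd (m : CurvePoly →₀ ℕ) :
    (curveProd m).IsHomogeneous (m.sum fun q e => q.1.totalDegree * e) :=
  IsHomogeneous.prod _ _ _ fun q _ => q.isHomogeneous.pow _

theorem dvd_curveProd {m : CurvePoly →₀ ℕ} {q : CurvePoly} (hq : q ∈ m.support) :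
    q.1 ∣ curveProd m :=
  (dvd_pow_self q.1 (Finsupp.mem_support_iff.1 hq)).trans
    (Finset.dvd_prod_of_mem (fun q : CurvePoly => q.1 ^ m q) hq)

theorem mem_support_of_dvd_curveProd {m : CurvePoly →₀ ℕ} {q : CurvePoly}
    (hq : q.1 ∣ curveProd m) : q ∈ m.support := by
  obtain ⟨p, hp, h⟩ := (q.irreducible.prime.dvd_finsetProd_iff _).1 hq
  rwa [CurvePoly.eq_of_dvd (q.irreducible.prime.dvd_of_dvd_pow h)]

theorem exists_eq_C_mul_curveProd {u : Poly} {d : ℕ} (hu : u.IsHomogeneous d) (h0 : u ≠ 0) :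
    ∃ (a : ℂ) (m : CurvePoly →₀ ℕ), a ≠ 0 ∧ u = C a * curveProd m := by
  classical
  refine homogeneous_induction
    (P := fun u => ∃ (a : ℂ) (m : CurvePoly →₀ ℕ), a ≠ 0 ∧ u = C a * curveProd m)
    (fun a ha => ⟨a, 0, ha, by simp [curveProd]⟩) ?_ hu h0
  · rintro q u d - - ⟨a, m, ha, rfl⟩
    refine ⟨a, Finsupp.single q 1 + m, ha, ?_⟩
    rw [curveProd, curveProd, Finsupp.prod_add_index' (by simp) (by simp [pow_add]),
      Finsupp.prod_single_index (by simp), pow_one]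
    ring

/-- A rational function on the plane in lowest terms. -/
theorem exists_eq_div_curveProd (G : FunField) :
    ∃ (u : Poly) (m : CurvePoly →₀ ℕ), u.IsHomogeneous (m.sum fun q e => q.1.totalDegree * e) ∧
      (∀ q ∈ m.support, ¬ q.1 ∣ u) ∧ (G : RatC3) = toRat u / toRat (curveProd m) := by
  obtain ⟨G, d, u, v, hu, hv, h0, rfl⟩ := G
  obtain ⟨u, v, w, huv, rfl, rfl⟩ := UniqueFactorizationMonoid.exists_reduced_factors' u v h0
  have hw0 := left_ne_zero_of_mul h0
  have hv0 := right_ne_zero_of_mul h0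
  have hv' := isHomogeneous_of_dvd hv h0 (dvd_mul_left v w)
  obtain ⟨a, m, ha, hm⟩ := exists_eq_C_mul_curveProd hv' hv0
  have hu' : u.IsHomogeneous v.totalDegree := by
    rcases eq_or_ne u 0 with rfl | hu0
    · exact isHomogeneous_zero _ _ _
    · have hu' := isHomogeneous_of_dvd hu (mul_ne_zero hw0 hu0) (dvd_mul_left u w)
      have hw := isHomogeneous_of_dvd hv h0 (dvd_mul_right w v)
      have h1 := (hw.mul hv').inj_right hv h0
      have h2 := (hw.mul hu').inj_right hu (mul_ne_zero hw0 hu0)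
      rwa [show v.totalDegree = u.totalDegree by omega]
  have hdeg : v.totalDegree = m.sum fun q e => q.1.totalDegree * e :=
    hv'.inj_right (hm ▸ (isHomogeneous_curveProd m).C_mul a) hv0
  refine ⟨C a⁻¹ * u, m, hdeg ▸ hu'.C_mul _, fun q hq h => ?_, ?_⟩
  · have h1 : q.1 ∣ u := by
      have := h.mul_left (C a)
      rwa [← mul_assoc, ← map_mul, mul_inv_cancel₀ ha, map_one, one_mul] at this
    exact q.irreducible.not_isUnit
      (huv h1 (hm ▸ (dvd_curveProd hq).mul_left (C a)))
  · change toRat (w * u) / toRat (w * v) = _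
    have h1 := toRat_ne_zero hw0
    have h2 := toRat_ne_zero (curveProd_ne_zero m)
    have h3 : toRat (C a) ≠ 0 := toRat_ne_zero (by simpa using ha)
    have h4 : toRat (C a) * toRat (C a⁻¹) = 1 := by
      rw [← map_mul, ← map_mul, mul_inv_cancel₀ ha, map_one, map_one]
    rw [map_mul, map_mul, mul_div_mul_left _ _ h1, hm, map_mul, map_mul,
      div_eq_div_iff (mul_ne_zero h3 h2) h2]
    linear_combination (-toRat u * toRat (curveProd m)) * h4

end Homogeneous

/-! ### The normal form of a closed form -/

section NormalForm

open KaehlerDifferential (D)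

/-- The logarithmic differential `dp / p` of a polynomial. -/
def dlog (p : Poly) : Ω[RatC3⁄ℂ] := (toRat p)⁻¹ • D ℂ RatC3 (toRat p)

theorem dlog_mul {p q : Poly} (hp : p ≠ 0) (hq : q ≠ 0) : dlog (p * q) = dlog p + dlog q := by
  have hp' := toRat_ne_zero hp
  have hq' := toRat_ne_zero hq
  rw [dlog, map_mul, Derivation.leibniz, smul_add, smul_smul, smul_smul, add_comm, dlog, dlog]
  congr 2 <;> field_simp

theorem D_toRat_C (a : ℂ) : D ℂ RatC3 (toRat (C a)) = 0 := by
  have : toRat (C a) = algebraMap ℂ RatC3 a := by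
    rw [IsScalarTower.algebraMap_apply ℂ Poly RatC3]
    rfl
  rw [this, Derivation.map_algebraMap]

theorem dlog_C (a : ℂ) : dlog (C a) = 0 := by rw [dlog, D_toRat_C, smul_zero]

theorem dlog_pow {p : Poly} (hp : p ≠ 0) (m : ℕ) : dlog (p ^ m) = (m : ℂ) • dlog p := by
  induction m with
  | zero => rw [pow_zero, ← C_1, dlog_C, Nat.cast_zero, zero_smul]
  | succ m ih =>
    rw [pow_succ, dlog_mul (pow_ne_zero m hp) hp, ih, Nat.cast_succ, add_smul, one_smul]

theorem inv_smul_D_div {u v : Poly} (hu : u ≠ 0) (hv : v ≠ 0) :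
    (toRat u / toRat v)⁻¹ • D ℂ RatC3 (toRat u / toRat v) = dlog u - dlog v := by
  have hu' := toRat_ne_zero hu
  have hv' := toRat_ne_zero hv
  rw [Derivation.leibniz_div, smul_smul, smul_sub, smul_smul, smul_smul, dlog, dlog]
  congr 2 <;> field_simp

theorem exists_dlog_eq_linearCombination {u : Poly} {d : ℕ} (hu : u.IsHomogeneous d)
    (h0 : u ≠ 0) : ∃ c : CurvePoly →₀ ℂ,
      dlog u = Finsupp.linearCombination ℂ (fun q : CurvePoly => dlog q.1) c ∧
      (u.totalDegree : ℂ) =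
        Finsupp.linearCombination ℂ (fun q : CurvePoly => (q.1.totalDegree : ℂ)) c := by
  refine homogeneous_induction (P := fun u => ∃ c : CurvePoly →₀ ℂ,
      dlog u = Finsupp.linearCombination ℂ (fun q : CurvePoly => dlog q.1) c ∧
      (u.totalDegree : ℂ) =
        Finsupp.linearCombination ℂ (fun q : CurvePoly => (q.1.totalDegree : ℂ)) c)
    (fun a _ => ⟨0, by simp [dlog_C], by simp⟩) ?_ hu h0
  rintro q u d hu0 hu ⟨c, hc, hdeg⟩
  refine ⟨Finsupp.single q 1 + c, ?_, ?_⟩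
  · rw [map_add, Finsupp.linearCombination_single, one_smul, ← hc, dlog_mul q.ne_zero hu0]
  · rw [map_add, Finsupp.linearCombination_single, one_smul, ← hdeg,
      totalDegree_mul_of_isDomain q.ne_zero hu0, Nat.cast_add]

theorem exists_lift_eq_of_mem_logExact {ω : RatForm} (hω : ω ∈ logExact (D ℂ FunField)) :
    ∃ (c : CurvePoly →₀ ℂ) (G : FunField),
      lift ω = Finsupp.linearCombination ℂ (fun q : CurvePoly => dlog q.1) c +
        D ℂ RatC3 (G : RatC3) ∧
      Finsupp.linearCombination ℂ (fun q : CurvePoly => (q.1.totalDegree : ℂ)) c = 0 := by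
  induction hω using logExact_induction with
  | exact G => exact ⟨0, G, by rw [lift_D, map_zero, zero_add], map_zero _⟩
  | log F hF =>
    obtain ⟨F, d, u, v, hu, hv, hv0, rfl⟩ := F
    have hu0 : u ≠ 0 := by
      rintro rfl
      exact hF (Subtype.ext (by simp))
    obtain ⟨c, hc, hcd⟩ := exists_dlog_eq_linearCombination hu hu0
    obtain ⟨e, he, hed⟩ := exists_dlog_eq_linearCombination hv hv0
    refine ⟨c - e, 0, ?_, ?_⟩
    · rw [lift_smul, lift_D, map_sub, ← hc, ← he]
      push_cast
      rw [map_zero, add_zero]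
      exact inv_smul_D_div hu0 hv0
    · rw [map_sub, ← hcd, ← hed, hu.totalDegree hu0, hv.totalDegree hv0, sub_self]
  | add x y _ _ hx hy =>
    obtain ⟨c, G, hc, hcd⟩ := hx
    obtain ⟨e, H, he, hed⟩ := hy
    refine ⟨c + e, G + H, ?_, by rw [map_add, hcd, hed, add_zero]⟩
    rw [lift_add, hc, he, map_add]
    push_cast
    rw [map_add]
    abel
  | smul a x _ hx =>
    obtain ⟨c, G, hc, hcd⟩ := hx
    refine ⟨a • c, a • G, ?_, by rw [map_smul, hcd, smul_zero]⟩
    rw [lift_smul_complex, hc, map_smul, smul_add, ← Derivation.map_smul]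
    rfl

/-- The expression of `π^*ω` as the sum of the `cⱼ dfⱼ / fⱼ` and of the differential of
`g / ∏ fⱼ ^ (nⱼ - 1)`, where the `fⱼ` are distinct irreducible curves, `g` is coprime to each of
them, and every `fⱼ` contributes a pole. -/
structure IsNormalForm {r : ℕ} (ω : RatForm) (f : Fin r → Poly) (g : Poly) (n : Fin r → ℕ)
    (c : Fin r → ℂ) : Prop where
  lift_eq : lift ω = ∑ j, c j • dlog (f j) + D ℂ RatC3 (toRat g / ∏ j, toRat (f j) ^ (n j - 1))
  isHomogeneous : ∀ j, (f j).IsHomogeneous (f j).totalDegree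
  irreducible : ∀ j, Irreducible (f j)
  eq_of_associated : ∀ i j, Associated (f i) (f j) → i = j
  isHomogeneous_num : g.IsHomogeneous (∑ j, (f j).totalDegree * (n j - 1))
  not_dvd : ∀ j, ¬ f j ∣ g
  sum_eq_zero : ∑ j, c j * ((f j).totalDegree : ℂ) = 0
  one_le : ∀ j, 1 ≤ n j
  ne_zero : ∀ j, n j = 1 → c j ≠ 0

/-- Adding a constant to `u / ∏ q ^ m q` makes its numerator coprime to any finite set of curves. -/
theorem exists_not_dvd_add_C_mul (T : Finset CurvePoly) {u : Poly} {m : CurvePoly →₀ ℕ}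
    (hu : ∀ q ∈ m.support, ¬ q.1 ∣ u) :
    ∃ a : ℂ, ∀ q ∈ T, ¬ q.1 ∣ u + C a * curveProd m := by
  have hfin : (⋃ q ∈ (T : Set CurvePoly), {a : ℂ | q.1 ∣ u + C a * curveProd m}).Finite := by
    refine T.finite_toSet.biUnion fun q _ => Set.Subsingleton.finite fun a ha b hb => ?_
    change q.1 ∣ _ at ha hb
    by_contra hab
    have h1 : q.1 ∣ C (a - b) * curveProd m := by
      have := dvd_sub ha hb
      rwa [add_sub_add_left_eq_sub, ← sub_mul, ← map_sub] at this
    have h2 : q.1 ∣ curveProd m := by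
      have hu : IsUnit (C (a - b) : Poly) :=
        (IsUnit.mk0 _ (sub_ne_zero.2 hab)).map (C : ℂ →+* Poly)
      exact hu.dvd_mul_left.1 h1
    exact hu q (mem_support_of_dvd_curveProd h2) ((dvd_add_left (h2.mul_left _)).1 ha)
  obtain ⟨a, ha⟩ := hfin.infinite_compl.nonempty
  refine ⟨a, fun q hq h => ha ?_⟩
  simp only [Set.mem_iUnion]
  exact ⟨q, hq, h⟩

theorem exists_isNormalForm {ω : RatForm} (hω : ClosedForm ω) :
    ∃ (r : ℕ) (f : Fin r → Poly) (g : Poly) (n : Fin r → ℕ) (c : Fin r → ℂ),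
      IsNormalForm ω f g n c := by
  classical
  obtain ⟨c, G, hωc, hcd⟩ := exists_lift_eq_of_mem_logExact hω.mem_logExact
  obtain ⟨u, m, hu, hum, hG⟩ := exists_eq_div_curveProd G
  set T : Finset CurvePoly := c.support ∪ m.support
  obtain ⟨a, ha⟩ := exists_not_dvd_add_C_mul T hum
  have hP := toRat_ne_zero (curveProd_ne_zero m)
  have hsum {M : Type} [AddCommMonoid M] (F : CurvePoly → M) :
      ∑ j, F (T.equivFin.symm j).1 = ∑ q ∈ T, F q := by
    rw [Equiv.sum_comp T.equivFin.symm (fun q : T => F q.1), Finset.sum_coe_sort]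
  have hprod : ∏ j, toRat (T.equivFin.symm j).1.1 ^ (m (T.equivFin.symm j).1 + 1 - 1) =
      toRat (curveProd m) := by
    simp only [Nat.add_sub_cancel]
    rw [Equiv.prod_comp T.equivFin.symm (fun q : T => toRat q.1.1 ^ m q.1),
      Finset.prod_coe_sort T (fun q => toRat q.1 ^ m q), curveProd, Finsupp.prod, map_prod]
    simp only [map_pow]
    refine (Finset.prod_subset Finset.subset_union_right fun q _ hq => ?_).symm
    rw [Finsupp.notMem_support_iff.1 hq, pow_zero]
  have hdeg : ∑ j, (T.equivFin.symm j).1.1.totalDegree * (m (T.equivFin.symm j).1 + 1 - 1) =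
      m.sum fun q e => q.1.totalDegree * e := by
    simp only [Nat.add_sub_cancel]
    rw [hsum fun q => q.1.totalDegree * m q]
    refine (Finset.sum_subset Finset.subset_union_right fun q _ hq => ?_).symm
    rw [Finsupp.notMem_support_iff.1 hq, mul_zero]
  refine ⟨T.card, fun j => (T.equivFin.symm j).1.1, u + C a * curveProd m,
    fun j => m (T.equivFin.symm j).1 + 1, fun j => c (T.equivFin.symm j).1, ?_, ?_, ?_, ?_, ?_, ?_,
    ?_, ?_, ?_⟩
  · have h1 : toRat (u + C a * curveProd m) / toRat (curveProd m) =
        (G : RatC3) + toRat (C a) := by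
      rw [hG, map_add, map_mul]
      field_simp
    rw [hprod, h1, map_add, D_toRat_C, add_zero, hωc, Finsupp.linearCombination_apply, Finsupp.sum]
    congr 1
    rw [Equiv.sum_comp T.equivFin.symm (fun q : T => c q.1 • dlog q.1.1),
      Finset.sum_coe_sort T (fun q => c q • dlog q.1)]
    refine Finset.sum_subset Finset.subset_union_left fun q _ hq => ?_
    rw [Finsupp.notMem_support_iff.1 hq, zero_smul]
  · exact fun j => (T.equivFin.symm j).1.isHomogeneous
  · exact fun j => (T.equivFin.symm j).1.irreducible
  · exact fun i j h => T.equivFin.symm.injective (Subtype.ext (CurvePoly.eq_of_associated h))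
  · rw [hdeg]
    exact hu.add ((isHomogeneous_curveProd m).C_mul a)
  · exact fun j => ha _ (T.equivFin.symm j).2
  · rw [hsum fun q => c q * (q.1.totalDegree : ℂ), ← hcd]
    refine (Finset.sum_subset Finset.subset_union_left fun q _ hq => ?_).symm
    rw [Finsupp.notMem_support_iff.1 hq, zero_mul]
  · exact fun j => Nat.le_add_left 1 _
  · intro j hj
    have h1 : m (T.equivFin.symm j).1 = 0 := by simpa using hj
    have h2 : (T.equivFin.symm j).1 ∈ c.support ∪ m.support := (T.equivFin.symm j).2
    rw [Finset.mem_union, Finsupp.mem_support_iff, Finsupp.mem_support_iff] at h2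
    exact h2.resolve_right (not_not.2 h1)

end NormalForm

/-! ### Poles -/

section Poles

open KaehlerDifferential (D)

/-- The rational functions on `ℂ³` with a denominator in `S`. -/
def coeffRing (S : Submonoid Poly) : Subring RatC3 where
  carrier := {a | ∃ p w : Poly, w ≠ 0 ∧ w ∈ S ∧ a = toRat p / toRat w}
  mul_mem' := by
    rintro a b ⟨p, w, h0, hw, rfl⟩ ⟨p', w', h0', hw', rfl⟩
    exact ⟨p * p', w * w', mul_ne_zero h0 h0', S.mul_mem hw hw', by
      rw [map_mul, map_mul, div_mul_div_comm]⟩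
  one_mem' := ⟨1, 1, one_ne_zero, S.one_mem, by simp⟩
  add_mem' := by
    rintro a b ⟨p, w, h0, hw, rfl⟩ ⟨p', w', h0', hw', rfl⟩
    refine ⟨p * w' + w * p', w * w', mul_ne_zero h0 h0', S.mul_mem hw hw', ?_⟩
    rw [div_add_div _ _ (toRat_ne_zero h0) (toRat_ne_zero h0')]
    simp
  zero_mem' := ⟨0, 1, one_ne_zero, S.one_mem, by simp⟩
  neg_mem' := by
    rintro a ⟨p, w, h0, hw, rfl⟩
    exact ⟨-p, w, h0, hw, by rw [map_neg]; exact (neg_div _ _).symm⟩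

theorem div_mem_coeffRing {S : Submonoid Poly} (p : Poly) {w : Poly} (h0 : w ≠ 0) (hw : w ∈ S) :
    toRat p / toRat w ∈ coeffRing S := ⟨p, w, h0, hw, rfl⟩

theorem toRat_mem_coeffRing (S : Submonoid Poly) (p : Poly) : toRat p ∈ coeffRing S :=
  ⟨p, 1, one_ne_zero, S.one_mem, by simp⟩

theorem coeffRing_mono {S T : Submonoid Poly} (h : S ≤ T) : coeffRing S ≤ coeffRing T := by
  rintro a ⟨p, w, h0, hw, rfl⟩
  exact ⟨p, w, h0, h hw, rfl⟩

theorem ratPderiv_mem_coeffRing {S : Submonoid Poly} (i : Fin 3) {a : RatC3}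
    (ha : a ∈ coeffRing S) : ratPderiv i a ∈ coeffRing S := by
  obtain ⟨p, w, h0, hw, rfl⟩ := ha
  refine ⟨w * pderiv i p - p * pderiv i w, w ^ 2, pow_ne_zero 2 h0, S.pow_mem hw 2, ?_⟩
  rw [Derivation.leibniz_div, ratPderiv_toRat, ratPderiv_toRat]
  simp only [map_sub, map_mul, map_pow, smul_eq_mul]
  rw [inv_pow, div_eq_inv_mul]

theorem dvd_of_div_mem_coeffRing {f e : Poly} (hf : Irreducible f)
    (h : toRat e / toRat f ∈ coeffRing (nonvanishingAlong f)) : f ∣ e := by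
  obtain ⟨p, w, h0, hw, h⟩ := h
  rw [div_eq_div_iff (toRat_ne_zero hf.ne_zero) (toRat_ne_zero h0), ← map_mul, ← map_mul] at h
  have h' : e * w = p * f := IsFractionRing.injective Poly RatC3 h
  exact (hf.prime.dvd_or_dvd (Dvd.intro_left p h'.symm)).resolve_right
    ((mem_nonvanishingAlong hf w).1 hw)

theorem nonvanishingAt_le_nonvanishingAlong {f : Poly} (hf : Irreducible f) {v : Fin 3 → ℂ}
    (hv : eval v f = 0) : nonvanishingAt v ≤ nonvanishingAlong f := fun w hw => by
  rw [mem_nonvanishingAlong hf]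
  rintro ⟨u, rfl⟩
  exact hw (by rw [map_mul, hv, zero_mul])

/-- The coefficient of `dxᵢ` in `π^*ω`. -/
def coeffForm (i : Fin 3) (ω : RatForm) : RatC3 :=
  (ratPderiv i).liftKaehlerDifferential (lift ω)

theorem coeffForm_smul (i : Fin 3) (a : FunField) (ω : RatForm) :
    coeffForm i (a • ω) = (a : RatC3) * coeffForm i ω := by
  rw [coeffForm, lift_smul, map_smul, smul_eq_mul, coeffForm]

theorem coeffForm_mem_coeffRing {S : Submonoid Poly} {ω : RatForm} (hω : ω ∈ regularForms S)
    (i : Fin 3) : coeffForm i ω ∈ coeffRing S := by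
  induction hω using Submodule.span_induction with
  | mem x hx =>
    obtain ⟨b, ⟨d, u, v, -, -, h0, hS, hb⟩, rfl⟩ := hx
    change (ratPderiv i).liftKaehlerDifferential (lift (D ℂ FunField b)) ∈ _
    rw [lift_D, Derivation.liftKaehlerDifferential_comp_D, hb]
    exact ratPderiv_mem_coeffRing i (div_mem_coeffRing u h0 hS)
  | zero => simp [coeffForm, lift]
  | add x y _ _ hx hy =>
    rw [coeffForm, lift_add, map_add]
    exact add_mem hx hy
  | smul a x _ hx =>
    obtain ⟨a, d, u, v, -, -, h0, hS, ha⟩ := a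
    have h := coeffForm_smul i a x
    rw [ha] at h
    exact (congrArg (· ∈ coeffRing S) h).mpr (mul_mem (div_mem_coeffRing u h0 hS) hx)

theorem complex_smul_eq (a : ℂ) (x : RatC3) : a • x = toRat (C a) * x := by
  rw [Algebra.smul_def, IsScalarTower.algebraMap_apply ℂ Poly RatC3]
  rfl

theorem liftKaehlerDifferential_dlog (i : Fin 3) (p : Poly) :
    (ratPderiv i).liftKaehlerDifferential (dlog p) = toRat (pderiv i p) / toRat p := by
  rw [dlog, map_smul, Derivation.liftKaehlerDifferential_comp_D, ratPderiv_toRat, smul_eq_mul,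
    div_eq_inv_mul]

/-- An irreducible homogeneous polynomial does not divide all its partial derivatives, by Euler's
identity. -/
theorem exists_not_dvd_pderiv {f : Poly} (hf : Irreducible f)
    (hd : f.IsHomogeneous f.totalDegree) : ∃ i, ¬ f ∣ pderiv i f := by
  by_contra! h
  have hdeg : f.totalDegree ≠ 0 := fun h0 => by
    rw [totalDegree_eq_zero_iff_eq_C] at h0
    rw [h0] at hf
    have hc : f.coeff 0 ≠ 0 := fun hc => hf.ne_zero (by rw [hc, map_zero])
    exact hf.not_isUnit ((IsUnit.mk0 _ hc).map (C : ℂ →+* Poly))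
  have hzero : ∀ i, pderiv i f = 0 := fun i => by
    by_contra h0
    obtain ⟨q, hq⟩ := h i
    have h1 := (hd.pderiv (i := i)).totalDegree h0
    have hq0 : q ≠ 0 := by
      rintro rfl
      exact h0 (by rw [hq, mul_zero])
    rw [hq, totalDegree_mul_of_isDomain hf.ne_zero hq0] at h1
    omega
  have h1 := hd.sum_X_mul_pderiv
  simp only [hzero, mul_zero, Finset.sum_const_zero] at h1
  rw [eq_comm, nsmul_eq_mul, mul_eq_zero] at h1
  rcases h1 with h1 | h1
  · exact hdeg (by exact_mod_cast h1)
  · exact hf.ne_zero h1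

theorem X_not_dvd_X {i j : Fin 3} (h : i ≠ j) : ¬ (X i : Poly) ∣ X j := by
  rintro ⟨q, hq⟩
  have := congrArg (eval (Pi.single j 1)) hq
  rw [map_mul, eval_X, eval_X, Pi.single_eq_same, Pi.single_eq_of_ne h, zero_mul] at this
  exact one_ne_zero this

/-- Every irreducible curve misses one of the coordinate lines generically. -/
theorem exists_X_mem_nonvanishingAlong {f : Poly} (hf : Irreducible f) :
    ∃ i, X i ∈ nonvanishingAlong f := by
  simp only [mem_nonvanishingAlong hf]
  by_contra! h
  have h0 : Associated f (X 0) := hf.associated_of_dvd (X_prime (i := 0)).irreducible (h 0)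
  exact X_not_dvd_X (by decide : (0 : Fin 3) ≠ 1) (h0.symm.dvd.trans (h 1))

section LocalRing

variable {S : Submonoid Poly}

theorem quot_mem_localRing {d : ℕ} {u v : Poly} (hu : u.IsHomogeneous d) (hv : v.IsHomogeneous d)
    (h0 : v ≠ 0) (hS : v ∈ S) : quot hu hv h0 ∈ localRing S := ⟨d, u, v, hu, hv, h0, hS, rfl⟩

theorem smul_mem_regularForms {b : FunField} (hb : b ∈ localRing S) {ω : RatForm}
    (hω : ω ∈ regularForms S) : b • ω ∈ regularForms S :=
  (regularForms S).smul_mem (⟨b, hb⟩ : localRing S) hω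

theorem smul_complex_mem_regularForms (c : ℂ) {ω : RatForm} (hω : ω ∈ regularForms S) :
    c • ω ∈ regularForms S := by
  rw [← algebraMap_smul FunField c ω]
  exact smul_mem_regularForms ((localRing S).algebraMap_mem c) hω

theorem D_mem_regularForms {b : FunField} (hb : b ∈ localRing S) :
    D ℂ FunField b ∈ regularForms S := Submodule.subset_span ⟨b, hb, rfl⟩

end LocalRing

namespace IsNormalForm

variable {r : ℕ} {ω : RatForm} {f : Fin r → Poly} {g : Poly} {n : Fin r → ℕ} {c : Fin r → ℂ}

theorem not_dvd_of_ne (h : IsNormalForm ω f g n c) {j k : Fin r} (hjk : j ≠ k) : ¬ f j ∣ f k :=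
  fun hd => hjk (h.eq_of_associated j k ((h.irreducible j).associated_of_dvd (h.irreducible k) hd))

theorem prod_ne_zero (h : IsNormalForm ω f g n c) (s : Finset (Fin r)) :
    ∏ k ∈ s, f k ^ (n k - 1) ≠ 0 :=
  Finset.prod_ne_zero_iff.2 fun k _ => pow_ne_zero _ (h.irreducible k).ne_zero

theorem isHomogeneous_prod (h : IsNormalForm ω f g n c) :
    (∏ k, f k ^ (n k - 1)).IsHomogeneous (∑ k, (f k).totalDegree * (n k - 1)) :=
  IsHomogeneous.prod _ _ _ fun k _ => (h.isHomogeneous k).pow _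

theorem not_dvd_prod_erase (h : IsNormalForm ω f g n c) (j : Fin r) :
    ¬ f j ∣ ∏ k ∈ Finset.univ.erase j, f k ^ (n k - 1) := fun hd => by
  obtain ⟨k, hk, hd⟩ := ((h.irreducible j).prime.dvd_finsetProd_iff _).1 hd
  exact h.not_dvd_of_ne (Finset.ne_of_mem_erase hk).symm
    ((h.irreducible j).prime.dvd_of_dvd_pow hd)

theorem coeffForm_eq (h : IsNormalForm ω f g n c) (i : Fin 3) :
    coeffForm i ω = ∑ k, c k • (toRat (pderiv i (f k)) / toRat (f k)) +
      ratPderiv i (toRat g / ∏ k, toRat (f k) ^ (n k - 1)) := by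
  rw [coeffForm, h.lift_eq, map_add, map_sum, Derivation.liftKaehlerDifferential_comp_D]
  simp only [LinearMap.map_smul_of_tower, liftKaehlerDifferential_dlog]

/-- The coefficients of the form have a pole of order at least `nⱼ` along `fⱼ`: the polar part of
`fⱼ ^ (nⱼ - 1) ω` is `(cⱼ fⱼ ^ (nⱼ - 1) - (nⱼ - 1) h) dfⱼ / fⱼ` with `h = g / ∏ fₖ ^ (nₖ - 1)`,
`k ≠ j`. -/
theorem pow_mul_coeffForm_notMem (h : IsNormalForm ω f g n c) {j : Fin r} {i : Fin 3}
    (hi : ¬ f j ∣ pderiv i (f j)) :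
    toRat (f j) ^ (n j - 1) * coeffForm i ω ∉ coeffRing (nonvanishingAlong (f j)) := by
  intro hmem
  have hirr := h.irreducible j
  set R := coeffRing (nonvanishingAlong (f j)) with hR
  set Q := ∏ k ∈ Finset.univ.erase j, f k ^ (n k - 1) with hQ
  have hQ0 : Q ≠ 0 := h.prod_ne_zero _
  have hQ' := toRat_ne_zero hQ0
  have hf' := toRat_ne_zero hirr.ne_zero
  have hQS : Q ∈ nonvanishingAlong (f j) :=
    (mem_nonvanishingAlong hirr _).2 (h.not_dvd_prod_erase j)
  set m := n j - 1 with hm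
  set H : RatC3 := toRat g / toRat Q with hH
  have hHR : H ∈ R := div_mem_coeffRing g hQ0 hQS
  have hG : toRat g / ∏ k, toRat (f k) ^ (n k - 1) = H / toRat (f j) ^ m := by
    rw [← Finset.mul_prod_erase _ _ (Finset.mem_univ j), hH, hQ, map_prod]
    simp only [map_pow]
    rw [div_div, mul_comm]
  have hother : ∑ k ∈ Finset.univ.erase j, c k • (toRat (pderiv i (f k)) / toRat (f k)) ∈ R := by
    refine sum_mem fun k hk => ?_
    rw [complex_smul_eq]
    exact mul_mem (toRat_mem_coeffRing _ _) (div_mem_coeffRing _ (h.irreducible k).ne_zero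
      ((mem_nonvanishingAlong hirr _).2 (h.not_dvd_of_ne (Finset.ne_of_mem_erase hk).symm)))
  have hexact : toRat (f j) ^ m * ratPderiv i (H / toRat (f j) ^ m) =
      ratPderiv i H - m * H * (toRat (pderiv i (f j)) / toRat (f j)) := by
    rcases Nat.eq_zero_or_pos m with h0 | h0
    · simp [h0]
    · have hm1 : toRat (f j) ^ m = toRat (f j) ^ (m - 1) * toRat (f j) := by
        rw [← pow_succ, Nat.sub_add_cancel h0]
      have hz := pow_ne_zero (m - 1) hf'
      rw [Derivation.leibniz_div, Derivation.leibniz_pow, ratPderiv_toRat]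
      simp only [smul_eq_mul, nsmul_eq_mul, hm1]
      field_simp
  have hpolar : toRat ((C (c j) * f j ^ m * Q - (m : Poly) * g) * pderiv i (f j)) / toRat (f j) ∈
      R := by
    have key : toRat ((C (c j) * f j ^ m * Q - (m : Poly) * g) * pderiv i (f j)) / toRat (f j) =
        toRat Q * (toRat (f j) ^ m * coeffForm i ω - toRat (f j) ^ m *
          ∑ k ∈ Finset.univ.erase j, c k • (toRat (pderiv i (f k)) / toRat (f k)) -
          ratPderiv i H) := by
      rw [h.coeffForm_eq i, hG, mul_add (toRat (f j) ^ m), hexact,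
        ← Finset.add_sum_erase _ _ (Finset.mem_univ j), complex_smul_eq]
      have hg : toRat g = H * toRat Q := by rw [hH]; field_simp
      simp only [map_mul, map_sub, map_pow, map_natCast, hg]
      field_simp
      ring
    rw [key]
    exact mul_mem (toRat_mem_coeffRing _ _) (sub_mem (sub_mem hmem
      (mul_mem (pow_mem (toRat_mem_coeffRing _ _) _) hother)) (ratPderiv_mem_coeffRing i hHR))
  have hdvd := ((hirr.prime.dvd_or_dvd (dvd_of_div_mem_coeffRing hirr hpolar)).resolve_right hi)
  rcases Nat.eq_zero_or_pos m with h0 | h0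
  · rw [h0, pow_zero, mul_one, Nat.cast_zero, zero_mul, sub_zero] at hdvd
    have hn : n j = 1 := by
      have := h.one_le j
      omega
    have hu : IsUnit (C (c j) : Poly) := (IsUnit.mk0 _ (h.ne_zero j hn)).map (C : ℂ →+* Poly)
    exact h.not_dvd_prod_erase j (hu.dvd_mul_left.1 hdvd)
  · have h1 : f j ∣ (m : Poly) * g := by
      refine (dvd_sub_right ?_).1 hdvd
      exact ((dvd_pow_self _ h0.ne').mul_left _).mul_right _
    have hu : IsUnit ((m : Poly)) := by
      rw [← map_natCast (C : ℂ →+* Poly)]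
      exact (IsUnit.mk0 _ (by exact_mod_cast h0.ne')).map (C : ℂ →+* Poly)
    exact h.not_dvd j (hu.dvd_mul_left.1 h1)

/-- The quotient of `fₖ` by a power of a coordinate, as a rational function on the plane. -/
def affinePart (h : IsNormalForm ω f g n c) (i : Fin 3) (k : Fin r) : FunField :=
  quot (h.isHomogeneous k) (isHomogeneous_X_pow i (f k).totalDegree) (pow_ne_zero _ (X_ne_zero i))

/-- The rational function of the exact part. -/
def exactPart (h : IsNormalForm ω f g n c) : FunField :=
  quot h.isHomogeneous_num h.isHomogeneous_prod (h.prod_ne_zero _)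

theorem affinePart_ne_zero (h : IsNormalForm ω f g n c) (i : Fin 3) (k : Fin r) :
    h.affinePart i k ≠ 0 := fun h0 => by
  have h1 : toRat (f k) / toRat (X i ^ (f k).totalDegree) = 0 := congrArg Subtype.val h0
  exact div_ne_zero (toRat_ne_zero (h.irreducible k).ne_zero)
    (toRat_ne_zero (pow_ne_zero _ (X_ne_zero i))) h1

/-- The normal form on the plane: the terms `dxᵢ / xᵢ` cancel because `∑ cⱼ deg fⱼ = 0`. -/
theorem eq_sum_add (h : IsNormalForm ω f g n c) (i : Fin 3) :
    ω = ∑ k, c k • ((h.affinePart i k)⁻¹ • D ℂ FunField (h.affinePart i k)) +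
      D ℂ FunField h.exactPart := by
  apply lift_injective
  rw [lift_add, lift_sum, lift_D, h.lift_eq]
  congr 1
  · have h1 : ∀ k, lift (c k • ((h.affinePart i k)⁻¹ • D ℂ FunField (h.affinePart i k))) =
        c k • dlog (f k) - (c k * ((f k).totalDegree : ℂ)) • dlog (X i) := fun k => by
      rw [lift_smul_complex, lift_smul, lift_D, mul_smul, ← smul_sub, ← dlog_pow (X_ne_zero i),
        ← inv_smul_D_div (h.irreducible k).ne_zero (pow_ne_zero _ (X_ne_zero i))]
      rfl
    simp only [h1]
    rw [Finset.sum_sub_distrib, ← Finset.sum_smul, h.sum_eq_zero, zero_smul, sub_zero]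
  · rw [exactPart, coe_quot, map_prod]
    simp only [map_pow]

end IsNormalForm

end Poles

/-! ### Polar set and pole orders of a normal form -/

section PoleOrder

open KaehlerDifferential (D)

theorem pow_succ_smul_apply_div_pow {k K M : Type*} [Field k] [Field K] [Algebra k K]
    [AddCommGroup M] [Module k M] [Module K M] (d : Derivation k K M) {F : K} (hF : F ≠ 0) (H : K)
    (m : ℕ) : F ^ (m + 1) • d (H / F ^ m) = F • d H - (m * H) • d F := by
  rw [Derivation.leibniz_div, Derivation.leibniz_pow, ← Nat.cast_smul_eq_nsmul K m]
  rcases Nat.eq_zero_or_pos m with h0 | h0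
  · simp [h0]
  · have hm1 : F ^ m = F ^ (m - 1) * F := by rw [← pow_succ, Nat.sub_add_cancel h0]
    have hz := pow_ne_zero (m - 1) hF
    simp only [smul_sub, smul_smul, pow_succ, hm1]
    congr 2 <;> field_simp

namespace IsNormalForm

variable {r : ℕ} {ω : RatForm} {f : Fin r → Poly} {g : Poly} {n : Fin r → ℕ} {c : Fin r → ℂ}
  {S : Submonoid Poly}

theorem coe_affinePart (h : IsNormalForm ω f g n c) (i : Fin 3) (k : Fin r) :
    (h.affinePart i k : RatC3) = toRat (f k) / toRat (X i ^ (f k).totalDegree) := rfl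

theorem coe_exactPart (h : IsNormalForm ω f g n c) :
    (h.exactPart : RatC3) = toRat g / toRat (∏ k, f k ^ (n k - 1)) := rfl

theorem affinePart_mem_localRing (h : IsNormalForm ω f g n c) {i : Fin 3} (hX : X i ∈ S)
    (k : Fin r) : h.affinePart i k ∈ localRing S :=
  quot_mem_localRing _ _ _ (S.pow_mem hX _)

theorem inv_affinePart_mem_localRing (h : IsNormalForm ω f g n c) (i : Fin 3) {k : Fin r}
    (hk : f k ∈ S) : (h.affinePart i k)⁻¹ ∈ localRing S :=
  ⟨_, X i ^ (f k).totalDegree, f k, isHomogeneous_X_pow i _, h.isHomogeneous k,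
    (h.irreducible k).ne_zero, hk, by rw [← inv_div]; rfl⟩

theorem log_mem_regularForms (h : IsNormalForm ω f g n c) {i : Fin 3} (hX : X i ∈ S) {k : Fin r}
    (hk : f k ∈ S) :
    (h.affinePart i k)⁻¹ • D ℂ FunField (h.affinePart i k) ∈ regularForms S :=
  smul_mem_regularForms (h.inv_affinePart_mem_localRing i hk)
    (D_mem_regularForms (h.affinePart_mem_localRing hX k))

theorem mem_regularForms (h : IsNormalForm ω f g n c) {i : Fin 3} (hX : X i ∈ S)
    (hS : ∀ k, f k ∈ S) : ω ∈ regularForms S := by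
  rw [h.eq_sum_add i]
  refine add_mem (sum_mem fun k _ => smul_complex_mem_regularForms _
    (h.log_mem_regularForms hX (hS k))) (D_mem_regularForms (quot_mem_localRing _ _ _ ?_))
  exact S.prod_mem fun k _ => S.pow_mem (hS k) _

/-- Multiplication by the `nⱼ`-th power of a local equation of `fⱼ` removes the pole. -/
theorem pow_smul_mem_regularForms (h : IsNormalForm ω f g n c) {i : Fin 3} {j : Fin r}
    (hX : X i ∈ nonvanishingAlong (f j)) :
    h.affinePart i j ^ n j • ω ∈ regularForms (nonvanishingAlong (f j)) := by
  have hirr := h.irreducible j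
  have hS : ∀ k, k ≠ j → f k ∈ nonvanishingAlong (f j) := fun k hk =>
    (mem_nonvanishingAlong hirr _).2 (h.not_dvd_of_ne hk.symm)
  obtain ⟨m, hm⟩ := Nat.exists_eq_add_of_le' (h.one_le j)
  have hm' : n j - 1 = m := by omega
  set F := h.affinePart i j with hF
  have hF0 : F ≠ 0 := h.affinePart_ne_zero i j
  have hFR : F ∈ localRing (nonvanishingAlong (f j)) := h.affinePart_mem_localRing hX j
  set Q := ∏ k ∈ Finset.univ.erase j, f k ^ (n k - 1) with hQ
  have hQ0 : Q ≠ 0 := h.prod_ne_zero _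
  have hQS : Q ∈ nonvanishingAlong (f j) :=
    (mem_nonvanishingAlong hirr _).2 (h.not_dvd_prod_erase j)
  set H : FunField := h.exactPart * F ^ m with hH
  have hHR : H ∈ localRing (nonvanishingAlong (f j)) := by
    refine ⟨_, g, Q * (X i ^ (f j).totalDegree) ^ m, h.isHomogeneous_num, ?_,
      mul_ne_zero hQ0 (pow_ne_zero _ (pow_ne_zero _ (X_ne_zero i))),
      mul_mem hQS (pow_mem (pow_mem hX _) _), ?_⟩
    · have h1 : Q.IsHomogeneous (∑ k ∈ Finset.univ.erase j, (f k).totalDegree * (n k - 1)) :=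
        IsHomogeneous.prod _ _ _ fun k _ => (h.isHomogeneous k).pow _
      rw [← Finset.sum_erase_add _ _ (Finset.mem_univ j), hm']
      exact h1.mul ((isHomogeneous_X_pow i _).pow m)
    · have h1 := toRat_ne_zero hirr.ne_zero
      have h2 := toRat_ne_zero hQ0
      have h3 := toRat_ne_zero (X_ne_zero (R := ℂ) i)
      rw [hH, hF, IntermediateField.coe_mul, IntermediateField.coe_pow, coe_exactPart,
        coe_affinePart, ← Finset.prod_erase_mul _ _ (Finset.mem_univ j), ← hQ, hm']
      simp only [map_mul, map_pow, div_pow]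
      field_simp
  have hG : h.exactPart = H / F ^ m := by rw [hH, mul_div_cancel_right₀ _ (pow_ne_zero m hF0)]
  have hexact : F ^ n j • D ℂ FunField h.exactPart =
      F • D ℂ FunField H - ((m : FunField) * H) • D ℂ FunField F := by
    rw [hG, hm]
    exact pow_succ_smul_apply_div_pow _ hF0 H m
  rw [h.eq_sum_add i, smul_add, hexact, Finset.smul_sum]
  refine add_mem (sum_mem fun k _ => ?_) (sub_mem (smul_mem_regularForms hFR
    (D_mem_regularForms hHR)) (smul_mem_regularForms (mul_mem (natCast_mem _ m) hHR)
      (D_mem_regularForms hFR)))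
  rw [smul_comm (F ^ n j) (c k)]
  refine smul_complex_mem_regularForms _ ?_
  rcases eq_or_ne k j with rfl | hk
  · rw [smul_smul, hm, pow_succ, mul_assoc, mul_inv_cancel₀ hF0, mul_one]
    exact smul_mem_regularForms (pow_mem hFR m) (D_mem_regularForms hFR)
  · exact smul_mem_regularForms (pow_mem hFR _) (h.log_mem_regularForms hX (hS k hk))

theorem hasPoleOrder (h : IsNormalForm ω f g n c) (j : Fin r) : HasPoleOrder (f j) ω (n j) := by
  have hirr := h.irreducible j
  have hf0 := hirr.ne_zero
  have hf' := toRat_ne_zero hf0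
  obtain ⟨i, hX⟩ := exists_X_mem_nonvanishingAlong hirr
  have hX' := toRat_ne_zero (X_ne_zero (R := ℂ) i)
  constructor
  · rintro a ⟨d, u, v, hu, hv, hv0, hvS, ha⟩
    set F := h.affinePart i j with hF
    have hF0 : F ≠ 0 := h.affinePart_ne_zero i j
    have hb : a / F ^ n j ∈ localRing (nonvanishingAlong (f j)) := by
      refine ⟨d, u * X i ^ ((f j).totalDegree * n j), v, ?_, hv, hv0, hvS, ?_⟩
      · rcases eq_or_ne u 0 with rfl | hu0
        · rw [zero_mul]
          exact isHomogeneous_zero _ _ _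
        · have hfu : f j ^ n j * u ≠ 0 := mul_ne_zero (pow_ne_zero _ hf0) hu0
          have hu' := isHomogeneous_of_dvd hu hfu (dvd_mul_left u _)
          have hd := (((h.isHomogeneous j).pow (n j)).mul hu').inj_right hu hfu
          rw [← hd, add_comm]
          exact hu'.mul (isHomogeneous_X_pow i _)
      · have hv' := toRat_ne_zero hv0
        rw [IntermediateField.coe_div, IntermediateField.coe_pow, ha, hF, coe_affinePart, pow_mul]
        simp only [map_mul, map_pow, div_pow]
        field_simp
    have hab : a • ω = (a / F ^ n j) • F ^ n j • ω := by
      rw [smul_smul, div_mul_cancel₀ _ (pow_ne_zero _ hF0)]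
    rw [hab]
    exact smul_mem_regularForms hb (h.pow_smul_mem_regularForms hX)
  · intro m hm
    by_contra! hlt
    obtain ⟨l, hl⟩ := exists_not_dvd_pderiv hirr (h.isHomogeneous j)
    have h1 := hm (h.affinePart i j ^ m) ⟨(f j).totalDegree * m, 1,
      (X i ^ (f j).totalDegree) ^ m, by rw [mul_one]; exact (h.isHomogeneous j).pow m,
      (isHomogeneous_X_pow i _).pow m, pow_ne_zero _ (pow_ne_zero _ (X_ne_zero i)),
      pow_mem (pow_mem hX _) _, by
        rw [IntermediateField.coe_pow, coe_affinePart, div_pow, mul_one, map_pow toRat (f j),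
          map_pow toRat _ m]⟩
    have h2 := coeffForm_mem_coeffRing h1 l
    rw [coeffForm_smul] at h2
    refine h.pow_mul_coeffForm_notMem hl ?_
    obtain ⟨e, he⟩ := Nat.exists_eq_add_of_lt hlt
    have he' : n j - 1 = e + m := by omega
    have key : toRat (f j) ^ (n j - 1) * coeffForm l ω =
        toRat (f j ^ e * (X i ^ (f j).totalDegree) ^ m) *
          (((h.affinePart i j ^ m : FunField) : RatC3) * coeffForm l ω) := by
      rw [IntermediateField.coe_pow, coe_affinePart, he', pow_add]
      simp only [map_mul, map_pow, div_pow]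
      field_simp
    rw [key]
    exact mul_mem (toRat_mem_coeffRing _ _) h2

theorem polarSet_eq (h : IsNormalForm ω f g n c) : polarSet ω = ⋃ j, curve (f j) := by
  ext p
  simp only [Set.mem_iUnion]
  constructor
  · intro hp
    by_contra! hcurve
    obtain ⟨i, hi⟩ := Function.ne_iff.1 p.rep_nonzero
    refine hp (h.mem_regularForms (i := i) ?_ fun k => hcurve k)
    change eval p.rep (X i) ≠ 0
    rwa [eval_X]
  · rintro ⟨j, hj⟩ hreg
    obtain ⟨l, hl⟩ := exists_not_dvd_pderiv (h.irreducible j) (h.isHomogeneous j)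
    exact h.pow_mul_coeffForm_notMem hl (mul_mem (pow_mem (toRat_mem_coeffRing _ _) _)
      (coeffRing_mono (nonvanishingAt_le_nonvanishingAlong (h.irreducible j) hj)
        (coeffForm_mem_coeffRing hreg l)))

end IsNormalForm

end PoleOrder

/-! ### Residues -/

section Residue

open KaehlerDifferential (D)

theorem D_toRat (p : Poly) :
    D ℂ RatC3 (toRat p) = ∑ i, toRat (pderiv i p) • D ℂ RatC3 (toRat (X i)) := by
  induction p using MvPolynomial.induction_on with
  | C a => simp [D_toRat_C]
  | add p q hp hq => simp only [map_add, hp, hq, add_smul, Finset.sum_add_distrib]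
  | mul_X p j hp =>
    simp only [pderiv_mul]
    rw [map_mul, Derivation.leibniz, hp, add_comm]
    simp only [map_add, map_mul, add_smul, Finset.sum_add_distrib, Finset.smul_sum]
    refine congrArg₂ (· + ·) ?_ ?_
    · exact Finset.sum_congr rfl fun i _ => by rw [smul_smul, mul_comm]
    · rw [Finset.sum_eq_single j]
      · simp
      · intro i _ hi
        simp [pderiv_X_of_ne hi.symm]
      · simp

theorem eq_sum_ratPderiv_smul (η : Ω[RatC3⁄ℂ]) :
    η = ∑ i, (ratPderiv i).liftKaehlerDifferential η • D ℂ RatC3 (toRat (X i)) := by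
  have h : (LinearMap.id : Ω[RatC3⁄ℂ] →ₗ[RatC3] Ω[RatC3⁄ℂ]) =
      ∑ i, (ratPderiv i).liftKaehlerDifferential.smulRight (D ℂ RatC3 (toRat (X i))) := by
    apply Derivation.liftKaehlerDifferential_unique
    apply ratC3_derivation_ext
    intro p
    change D ℂ RatC3 (toRat p) = (∑ i, (ratPderiv i).liftKaehlerDifferential.smulRight
      (D ℂ RatC3 (toRat (X i)))) (D ℂ RatC3 (toRat p))
    rw [LinearMap.sum_apply]
    simp only [LinearMap.smulRight_apply, Derivation.liftKaehlerDifferential_comp_D,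
      ratPderiv_toRat]
    exact D_toRat p
  have := LinearMap.congr_fun h η
  rwa [LinearMap.sum_apply] at this

section Evaluation

variable {v : Fin 3 → ℂ}

/-- A rational function can be evaluated through any denominator that does not vanish, not only in
lowest terms. -/
theorem ratEval_div (p : Poly) {w : Poly} (hw : eval v w ≠ 0) :
    ratEval v (toRat p / toRat w) = eval v p / eval v w := by
  set a : RatC3 := toRat p / toRat w with ha
  have hw0 : toRat w ≠ 0 := toRat_ne_zero (by rintro rfl; simp at hw)
  have hd0 : toRat (IsFractionRing.den Poly a : Poly) ≠ 0 :=
    toRat_ne_zero (nonZeroDivisors.coe_ne_zero _)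
  have h1 : IsFractionRing.num Poly a * w = p * (IsFractionRing.den Poly a : Poly) := by
    apply IsFractionRing.injective Poly RatC3
    have h2 := IsFractionRing.mk'_num_den' Poly a
    rw [div_eq_iff hd0] at h2
    rw [map_mul, map_mul]
    refine (congrArg (· * toRat w) h2).trans ?_
    rw [ha]
    field_simp
  obtain ⟨e, he⟩ : (IsFractionRing.den Poly a : Poly) ∣ w :=
    (IsFractionRing.num_den_reduced Poly a).symm.dvd_of_dvd_mul_left (Dvd.intro_left p h1.symm)
  have hd : eval v (IsFractionRing.den Poly a : Poly) ≠ 0 := fun h => hw (by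
    rw [he, map_mul, h, zero_mul])
  rw [ratEval, div_eq_div_iff hd hw, ← map_mul, ← map_mul, h1]

theorem ratEval_add {a b : RatC3} (ha : a ∈ coeffRing (nonvanishingAt v))
    (hb : b ∈ coeffRing (nonvanishingAt v)) : ratEval v (a + b) = ratEval v a + ratEval v b := by
  obtain ⟨p, w, h0, hw, rfl⟩ := ha
  obtain ⟨q, u, h0', hu, rfl⟩ := hb
  change eval v w ≠ 0 at hw
  change eval v u ≠ 0 at hu
  rw [ratEval_div p hw, ratEval_div q hu, div_add_div _ _ (toRat_ne_zero h0) (toRat_ne_zero h0'),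
    div_add_div _ _ hw hu, ← map_mul, ← map_mul, ← map_mul, ← map_add,
    ratEval_div _ (by rw [map_mul]; exact mul_ne_zero hw hu)]
  simp only [map_add, map_mul]

theorem ratEval_sum {ι : Type*} (s : Finset ι) {a : ι → RatC3}
    (ha : ∀ i ∈ s, a i ∈ coeffRing (nonvanishingAt v)) :
    ratEval v (∑ i ∈ s, a i) = ∑ i ∈ s, ratEval v (a i) := by
  classical
  induction s using Finset.induction_on with
  | empty => simpa using ratEval_div (v := v) 0 (w := 1) (by simp)
  | insert i s hi ih =>
    rw [Finset.sum_insert hi, Finset.sum_insert hi,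
      ratEval_add (ha i (Finset.mem_insert_self i s))
        (sum_mem fun j hj => ha j (Finset.mem_insert_of_mem hj)),
      ih fun j hj => ha j (Finset.mem_insert_of_mem hj)]

end Evaluation

/-! ### Contour integrals around a pole -/

theorem eventually_circleIntegral_eq {F q G : ℂ → ℂ} {c : ℂ} (hq : AnalyticAt ℂ q 0)
    (h : ∀ᶠ t in 𝓝[≠] (0 : ℂ), AnalyticAt ℂ G t ∧ F t = c * t⁻¹ + q t + deriv G t) :
    ∀ᶠ ρ in 𝓝[>] (0 : ℝ), (2 * (Real.pi : ℂ) * Complex.I)⁻¹ * (∮ t in C(0, ρ), F t) = c := by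
  rw [eventually_nhdsWithin_iff] at h
  obtain ⟨ε, hε, hball⟩ := Metric.eventually_nhds_iff_ball.1 (h.and hq.eventually_analyticAt)
  filter_upwards [Ioo_mem_nhdsGT hε] with ρ hρ
  have hsub : Metric.closedBall (0 : ℂ) ρ ⊆ Metric.ball 0 ε := Metric.closedBall_subset_ball hρ.2
  have hS : ∀ t ∈ Metric.sphere (0 : ℂ) ρ, t ∈ Metric.ball (0 : ℂ) ε ∧ t ≠ 0 := fun t ht =>
    ⟨hsub (Metric.sphere_subset_closedBall ht), Metric.ne_of_mem_sphere ht hρ.1.ne'⟩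
  have hGt : ∀ t ∈ Metric.sphere (0 : ℂ) ρ, AnalyticAt ℂ G t := fun t ht =>
    ((hball t (hS t ht).1).1 (hS t ht).2).1
  have hqd : DifferentiableOn ℂ q (Metric.closedBall 0 ρ) := fun t ht =>
    (hball t (hsub ht)).2.differentiableAt.differentiableWithinAt
  have i1 : CircleIntegrable (fun t : ℂ => c * t⁻¹) 0 ρ := by
    refine ContinuousOn.circleIntegrable hρ.1.le (continuousOn_const.mul ?_)
    exact continuousOn_inv₀.mono fun t ht => (hS t ht).2
  have i2 : CircleIntegrable q 0 ρ :=
    (hqd.continuousOn.mono Metric.sphere_subset_closedBall).circleIntegrable hρ.1.le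
  have i3 : CircleIntegrable (deriv G) 0 ρ := by
    refine ContinuousOn.circleIntegrable hρ.1.le fun t ht => ?_
    exact (hGt t ht).deriv.continuousAt.continuousWithinAt
  have e1 : (∮ t in C(0, ρ), t⁻¹) = 2 * (Real.pi : ℂ) * Complex.I := by
    simpa using circleIntegral.integral_sub_center_inv (0 : ℂ) hρ.1.ne'
  have e2 : (∮ t in C(0, ρ), q t) = 0 :=
    (hqd.diffContOnCl_ball subset_rfl).circleIntegral_eq_zero hρ.1.le
  have e3 : (∮ t in C(0, ρ), deriv G t) = 0 :=
    circleIntegral.integral_eq_zero_of_hasDerivWithinAt hρ.1.le fun t ht =>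
      (hGt t ht).differentiableAt.hasDerivAt.hasDerivWithinAt
  rw [circleIntegral.integral_congr hρ.1.le fun t ht =>
    ((hball t (hS t ht).1).1 (hS t ht).2).2]
  have i12 : CircleIntegrable (fun t : ℂ => c * t⁻¹ + q t) 0 ρ := i1.add i2
  rw [circleIntegral.integral_add i12 i3, circleIntegral.integral_add i1 i2,
    circleIntegral.integral_const_mul, e1, e2, e3, add_zero, add_zero, mul_comm c, ← mul_assoc,
    inv_mul_cancel₀ Complex.two_pi_I_ne_zero, one_mul]

/-- The logarithmic derivative at a simple zero is `t⁻¹` up to an analytic function. -/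
theorem exists_logDeriv_eq_inv_add {h : ℂ → ℂ} (hh : AnalyticAt ℂ h 0) (h0 : h 0 = 0)
    (h1 : deriv h 0 ≠ 0) : ∃ q : ℂ → ℂ, AnalyticAt ℂ q 0 ∧
      ∀ᶠ t in 𝓝[≠] (0 : ℂ), deriv h t / h t = t⁻¹ + q t := by
  obtain ⟨p, hp⟩ := hh
  have hu : AnalyticAt ℂ (dslope h 0) 0 := hp.has_fpower_series_dslope_fslope.analyticAt
  set u := dslope h 0 with hudef
  have hu0 : u 0 ≠ 0 := by rwa [hudef, dslope_same]
  have hmul : h = fun t => t * u t := by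
    funext t
    have := sub_smul_dslope h 0 t
    rw [h0, sub_zero, sub_zero, smul_eq_mul] at this
    exact this.symm
  refine ⟨fun t => deriv u t / u t, hu.deriv.div hu hu0, ?_⟩
  rw [eventually_nhdsWithin_iff]
  filter_upwards [hu.eventually_analyticAt, hu.continuousAt.eventually_ne hu0] with t ht hut ht0
  have hd : deriv h t = u t + t * deriv u t := by
    rw [hmul]
    have := ((hasDerivAt_id t).fun_mul ht.differentiableAt.hasDerivAt).deriv
    simpa using this
  have ht0' : t ≠ 0 := ht0
  rw [hd, congrFun hmul t]
  field_simp

theorem exists_logDeriv_eq {h : ℂ → ℂ} (hh : AnalyticAt ℂ h 0) (h0 : h 0 ≠ 0) :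
    ∃ q : ℂ → ℂ, AnalyticAt ℂ q 0 ∧ ∀ᶠ t in 𝓝[≠] (0 : ℂ), deriv h t / h t = q t :=
  ⟨fun t => deriv h t / h t, hh.deriv.div hh h0, Eventually.of_forall fun _ => rfl⟩

section Disc

variable {γ : ℂ → Fin 3 → ℂ} {t : ℂ}

theorem analyticAt_eval_comp (hγ : AnalyticAt ℂ γ t) (p : Poly) :
    AnalyticAt ℂ (fun t => eval (γ t) p) t := by
  have := AnalyticAt.aeval_mvPolynomial (analyticAt_pi_iff.1 hγ) p
  simpa [MvPolynomial.coe_aeval_eq_eval] using this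

/-- The chain rule for a polynomial along a disc. -/
theorem deriv_eval_comp (hγ : AnalyticAt ℂ γ t) (p : Poly) :
    deriv (fun t => eval (γ t) p) t = ∑ i, eval (γ t) (pderiv i p) * deriv γ t i := by
  refine HasDerivAt.deriv ?_
  have hγi : ∀ i, HasDerivAt (fun t => γ t i) (deriv γ t i) t :=
    hasDerivAt_pi.1 hγ.differentiableAt.hasDerivAt
  induction p using MvPolynomial.induction_on with
  | C a => simpa using hasDerivAt_const t a
  | add p q hp hq =>
    simp only [map_add, add_mul, Finset.sum_add_distrib]
    exact hp.add hq
  | mul_X p j hp =>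
    simp only [map_mul, eval_X, pderiv_mul, map_add, add_mul, Finset.sum_add_distrib]
    refine (hp.fun_mul (hγi j)).congr_deriv (congrArg₂ (· + ·) ?_ (Eq.symm ?_))
    · rw [Finset.sum_mul]
      exact Finset.sum_congr rfl fun i _ => by ring
    · rw [Finset.sum_eq_single j]
      · simp
      · intro i _ hi
        simp [pderiv_X_of_ne hi.symm]
      · simp

end Disc

namespace IsNormalForm

variable {r : ℕ} {ω : RatForm} {f : Fin r → Poly} {g : Poly} {n : Fin r → ℕ} {c : Fin r → ℂ}

/-- The pull-back of the form to a disc, away from the poles. -/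
theorem sum_ratEval_coeffForm (h : IsNormalForm ω f g n c) {γ : ℂ → Fin 3 → ℂ} {t : ℂ}
    (hγ : AnalyticAt ℂ γ t) (hf : ∀ k, eval (γ t) (f k) ≠ 0) :
    ∑ i, ratEval (γ t) (coeffForm i ω) * deriv γ t i =
      ∑ k, c k * (deriv (fun t => eval (γ t) (f k)) t / eval (γ t) (f k)) +
        deriv (fun t => eval (γ t) g / eval (γ t) (∏ k, f k ^ (n k - 1))) t := by
  set P := ∏ k, f k ^ (n k - 1) with hP
  have hP0 : toRat P ≠ 0 := toRat_ne_zero (h.prod_ne_zero _)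
  have hPt : eval (γ t) P ≠ 0 := by
    rw [hP, map_prod]
    exact Finset.prod_ne_zero_iff.2 fun k _ => by
      rw [map_pow]
      exact pow_ne_zero _ (hf k)
  have hP2t : eval (γ t) (P ^ 2) ≠ 0 := by
    rw [map_pow]
    exact pow_ne_zero 2 hPt
  have hcoeff : ∀ i, ratEval (γ t) (coeffForm i ω) =
      ∑ k, c k * eval (γ t) (pderiv i (f k)) / eval (γ t) (f k) +
        eval (γ t) (P * pderiv i g - g * pderiv i P) / eval (γ t) (P ^ 2) := fun i => by
    have h1 : coeffForm i ω = ∑ k, toRat (C (c k) * pderiv i (f k)) / toRat (f k) +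
        toRat (P * pderiv i g - g * pderiv i P) / toRat (P ^ 2) := by
      have hP' : ∏ k, toRat (f k) ^ (n k - 1) = toRat P := by
        rw [hP, map_prod]
        simp only [map_pow]
      rw [h.coeffForm_eq i, hP', Derivation.leibniz_div, ratPderiv_toRat, ratPderiv_toRat]
      congr 1
      · exact Finset.sum_congr rfl fun k _ => by rw [complex_smul_eq, map_mul, mul_div_assoc]
      · simp only [map_sub, map_mul, map_pow, smul_eq_mul]
        rw [inv_pow, div_eq_inv_mul]
    have hmem : ∀ k, toRat (C (c k) * pderiv i (f k)) / toRat (f k) ∈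
        coeffRing (nonvanishingAt (γ t)) := fun k =>
      div_mem_coeffRing _ (h.irreducible k).ne_zero (hf k)
    rw [h1, ratEval_add (sum_mem fun k _ => hmem k)
      (div_mem_coeffRing _ (pow_ne_zero 2 (h.prod_ne_zero _)) hP2t),
      ratEval_sum _ fun k _ => hmem k, ratEval_div _ hP2t]
    congr 1
    refine Finset.sum_congr rfl fun k _ => ?_
    rw [ratEval_div _ (hf k), map_mul, eval_C]
  have hderiv : deriv (fun t => eval (γ t) g / eval (γ t) P) t =
      (deriv (fun t => eval (γ t) g) t * eval (γ t) P -
        eval (γ t) g * deriv (fun t => eval (γ t) P) t) / eval (γ t) P ^ 2 :=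
    deriv_fun_div (analyticAt_eval_comp hγ g).differentiableAt
      (analyticAt_eval_comp hγ P).differentiableAt hPt
  rw [hderiv, deriv_eval_comp hγ g, deriv_eval_comp hγ P]
  simp only [hcoeff, add_mul, Finset.sum_add_distrib, deriv_eval_comp hγ]
  congr 1
  · simp only [Finset.sum_mul]
    rw [Finset.sum_comm]
    refine Finset.sum_congr rfl fun k _ => ?_
    rw [Finset.sum_div, Finset.mul_sum]
    exact Finset.sum_congr rfl fun i _ => by ring
  · rw [Finset.sum_mul, Finset.mul_sum, ← Finset.sum_sub_distrib, Finset.sum_div]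
    refine Finset.sum_congr rfl fun i _ => ?_
    simp only [map_sub, map_mul, map_pow]
    ring

theorem hasResidue (h : IsNormalForm ω f g n c) (j : Fin r) : HasResidue (f j) ω (c j) := by
  classical
  refine ⟨fun i => coeffForm i ω, eq_sum_ratPderiv_smul _, fun γ hγ => ?_⟩
  have hk0 : ∀ k, k ≠ j → eval (γ 0) (f k) ≠ 0 := fun k hk h0 =>
    hk (h.eq_of_associated k j (hγ.off_other_poles _ _ (h.irreducible k) (h.isHomogeneous k)
      (by rw [h.polarSet_eq]; exact Set.subset_iUnion (fun k => curve (f k)) k) h0))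
  have hlog : ∀ k, ∃ q : ℂ → ℂ, AnalyticAt ℂ q 0 ∧ ∀ᶠ t in 𝓝[≠] (0 : ℂ),
      deriv (fun t => eval (γ t) (f k)) t / eval (γ t) (f k) =
        (if k = j then t⁻¹ else 0) + q t := fun k => by
    have han := analyticAt_eval_comp hγ.analytic (f k)
    split_ifs with hk
    · subst hk
      exact exists_logDeriv_eq_inv_add han hγ.mem_curve hγ.transverse
    · simpa using exists_logDeriv_eq han (hk0 k hk)
  choose q hq hlog using hlog
  have hne : ∀ k, ∀ᶠ t in 𝓝[≠] (0 : ℂ), eval (γ t) (f k) ≠ 0 := fun k => by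
    have han := analyticAt_eval_comp hγ.analytic (f k)
    rcases eq_or_ne k j with rfl | hk
    · have := han.differentiableAt.hasDerivAt.eventually_ne (c := 0) hγ.transverse
      exact this
    · exact (han.continuousAt.eventually_ne (hk0 k hk)).filter_mono nhdsWithin_le_nhds
  refine eventually_circleIntegral_eq (q := fun t => ∑ k, c k * q k t)
    (G := fun t => eval (γ t) g / eval (γ t) (∏ k, f k ^ (n k - 1)))
    (Finset.analyticAt_fun_sum _ fun k _ => analyticAt_const.mul (hq k)) ?_
  filter_upwards [eventually_all.2 hlog, eventually_all.2 hne,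
    hγ.analytic.eventually_analyticAt.filter_mono nhdsWithin_le_nhds] with t hlog hne hγt
  refine ⟨(analyticAt_eval_comp hγt g).div (analyticAt_eval_comp hγt _) ?_, ?_⟩
  · rw [map_prod]
    exact Finset.prod_ne_zero_iff.2 fun k _ => by
      rw [map_pow]
      exact pow_ne_zero _ (hne k)
  · rw [h.sum_ratEval_coeffForm hγt hne]
    congr 1
    simp only [hlog, mul_add, Finset.sum_add_distrib]
    congr 1
    rw [Finset.sum_eq_single j (fun k _ hk => by rw [if_neg hk, mul_zero]) (by simp), if_pos rfl]

end IsNormalForm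

end Residue

/-! ### The number of polar curves -/

namespace IsNormalForm

variable {r : ℕ} {ω : RatForm} {f : Fin r → Poly} {g : Poly} {n : Fin r → ℕ} {c : Fin r → ℂ}

theorem totalDegree_num (h : IsNormalForm ω f g n c) :
    g.totalDegree = ∑ j, (f j).totalDegree * (n j - 1) := by
  rcases eq_or_ne g 0 with rfl | hg
  · rcases r with _ | r
    · simp
    · exact absurd (dvd_zero _) (h.not_dvd 0)
  · exact h.isHomogeneous_num.totalDegree hg

theorem one_le_card (h : IsNormalForm ω f g n c) (hω : ω ≠ 0) : 1 ≤ r := by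
  by_contra! hr
  obtain rfl : r = 0 := by omega
  refine hω (lift_injective ?_)
  have hg : g = C (g.coeff 0) := totalDegree_eq_zero_iff_eq_C.1 (by simpa using h.totalDegree_num)
  rw [h.lift_eq, hg]
  simp only [Finset.univ_eq_empty, Finset.sum_empty, Finset.prod_empty, div_one, D_toRat_C,
    add_zero]
  exact (map_zero (KaehlerDifferential.map ℂ ℂ FunField RatC3)).symm

/-- A single polar curve has residue zero, because `∑ cⱼ deg fⱼ = 0`; then the form is exact. -/
theorem two_le_card (h : IsNormalForm ω f g n c) (hω : ω ≠ 0)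
    (hexact : ¬ ∃ G : FunField, ω = KaehlerDifferential.D ℂ FunField G) : 2 ≤ r := by
  by_contra! hr
  obtain rfl : r = 1 := by
    have := h.one_le_card hω
    omega
  have hdeg : (f 0).totalDegree ≠ 0 := fun h0 => by
    have hC := totalDegree_eq_zero_iff_eq_C.1 h0
    have hc : (f 0).coeff 0 ≠ 0 := fun hc => (h.irreducible 0).ne_zero (by rw [hC, hc, map_zero])
    exact (h.irreducible 0).not_isUnit (hC ▸ (IsUnit.mk0 _ hc).map (C : ℂ →+* Poly))
  have hc : c 0 = 0 := by
    have := h.sum_eq_zero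
    rw [Fin.sum_univ_one, mul_eq_zero] at this
    exact this.resolve_right (by exact_mod_cast hdeg)
  refine hexact ⟨h.exactPart, ?_⟩
  conv_lhs => rw [h.eq_sum_add 0]
  rw [Fin.sum_univ_one, hc, zero_smul, zero_add]

end IsNormalForm

end CP2

end

theorem mainTheorem5 (ω : CP2.RatForm) (hω : ω ≠ 0) (hclosed : CP2.ClosedForm ω) :
    ∃ (r : ℕ) (f : Fin r → CP2.Poly) (g : CP2.Poly) (n : Fin r → ℕ) (c : Fin r → ℂ),
      CP2.lift ω =
        ∑ j, c j • ((CP2.toRat (f j))⁻¹ •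
          KaehlerDifferential.D ℂ CP2.RatC3 (CP2.toRat (f j))) +
        KaehlerDifferential.D ℂ CP2.RatC3
          (CP2.toRat g / ∏ j, CP2.toRat (f j) ^ (n j - 1)) ∧
      1 ≤ r ∧
      ((¬ ∃ h : CP2.FunField, ω = KaehlerDifferential.D ℂ CP2.FunField h) → 2 ≤ r) ∧
      (∀ j, (f j).IsHomogeneous (f j).totalDegree) ∧
      g.IsHomogeneous g.totalDegree ∧
      (∀ j, ¬ f j ∣ g) ∧
      (∀ j, Irreducible (f j)) ∧
      (∀ i j, i ≠ j → IsRelPrime (f i) (f j)) ∧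
      g.totalDegree = ∑ j, (f j).totalDegree * (n j - 1) ∧
      ∑ j, c j * ((f j).totalDegree : ℂ) = 0 ∧
      (∀ j, 1 ≤ n j) ∧
      (∀ j, n j = 1 → c j ≠ 0) ∧
      CP2.polarSet ω = ⋃ j, CP2.curve (f j) ∧
      (∀ j, CP2.HasPoleOrder (f j) ω (n j)) ∧
      (∀ j, CP2.HasResidue (f j) ω (c j)) := by
  obtain ⟨r, f, g, n, c, h⟩ := CP2.exists_isNormalForm hclosed
  refine ⟨r, f, g, n, c, h.lift_eq, h.one_le_card hω, h.two_le_card hω, h.isHomogeneous,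
    h.totalDegree_num ▸ h.isHomogeneous_num, h.not_dvd, h.irreducible, fun i j hij => ?_,
    h.totalDegree_num, h.sum_eq_zero, h.one_le, h.ne_zero, h.polarSet_eq, h.hasPoleOrder,
    h.hasResidue⟩
  exact (h.irreducible i).isRelPrime_iff_not_dvd.2 (h.not_dvd_of_ne hij)
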